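/- Let $k$ be a field of characteristic zero and put $F(s,t,u)=s^2+t^2+u^2-stu-4$. Let $M_0\subset\mathbb{A}^3_k$ be the Cayley cubic $F(s,t,u)=0$ and let $V=\mathbb{A}^3_k\setminus M_0$. Let $f\colon \mathrm{SL}(2)\times_k\mathrm{SL}(2)\to\mathbb{A}^3_k$ be the morphism $f(A,B)=(\mathrm{tr}(A),\mathrm{tr}(B),\mathrm{tr}(AB))$, and let $\mathcal{T}=f^{-1}(V)$, on which $\mathrm{PGL}(2)$ acts by simultaneous conjugation; $\mathcal{T}\to V$ is a $\mathrm{PGL}(2)$-torsor for the étale topology. Let $X=(\mathcal{T}\times_k\mathbb{P}^1_k)/\mathrm{PGL}(2)$ be the quotient, for the étale topology, by the diagonal action of $\mathrm{PGL}(2)$ (by simultaneous conjugation on $\mathcal{T}$ and by the standard action on $\mathbb{P}^1_k$), with the morphism $X\to V$ induced by $f$; this is a smooth conic bundle over $V$. Let $K=k(s,t,u)$ be the function field of $\mathbb{A}^3_k$ and let $X_K=X\times_V\mathrm{Spec}(K)$ be the generic fibre of $X\to V$. Then $X_K$ is a form of $\mathbb{P}^1$ over $K$ (a smooth projective conic),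 and its class, that is, the image of its class in $\mathrm{H}^1(K,\mathrm{PGL}(2))$ under the connecting map $\mathrm{H}^1(K,\mathrm{PGL}(2))\to\mathrm{H}^2(K,\mu_2)$ attached to $1\to\mu_2\to\mathrm{SL}(2)\to\mathrm{PGL}(2)\to1$, is $$[X_K]=(t^2-4,\,F(s,t,u))\in\mathrm{H}^2(K,\mu_2),$$ where $(a,b)$ denotes the quaternion symbol, i.e. the cup product of the classes of $a,b\in K^\times$ in $\mathrm{H}^1(K,\mu_2)=K^\times/K^{\times2}$, under the identification $\mu_2\otimes\mu_2=\mu_2$. -/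

import Mathlib

universe u w

namespace TraceConic

open CategoryTheory

noncomputable section

/-! ### Functors on `k`-algebras and quotients for the étale topology

Schemes over `k` and étale sheaves over `k` are given by their functors of points on commutative
`k`-algebras (equivalently, on affine `k`-schemes). -/

/-- The category of commutative algebras over `k`. -/
abbrev AlgOver (k : Type u) [CommRing k] : Type (u + 1) := Under (CommRingCat.of k)

/-- `Spec S ⟶ Spec R` is an étale covering: `R ⟶ S` is étale and faithfully flat.
(Finite coverings `{Spec Sᵢ ⟶ Spec R}` are included through `S = ∏ Sᵢ`.) -/
def IsEtaleCover {k : Type u} [CommRing k] {R S : AlgOver k} (f : R ⟶ S) : Prop :=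
  f.right.hom.Etale ∧ f.right.hom.FaithfullyFlat

theorem IsEtaleCover.baseChange {k : Type u} [CommRing k] {R S R' : AlgOver k} {f : R ⟶ S}
    (hf : IsEtaleCover f) (g : R ⟶ R') :
    ∃ (S' : AlgOver k) (f' : R' ⟶ S') (g' : S ⟶ S'), IsEtaleCover f' ∧ g ≫ f' = f ≫ g' := by
  let _ := f.right.hom.toAlgebra
  let _ := g.right.hom.toAlgebra
  have _ : Algebra.Etale R.right S.right := hf.1
  have _ : Module.FaithfullyFlat R.right S.right := hf.2
  have key : g.right ≫ CommRingCat.ofHom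
        (algebraMap R'.right (TensorProduct R.right R'.right S.right)) =
      f.right ≫ CommRingCat.ofHom (Algebra.TensorProduct.includeRight
        (R := R.right) (A := R'.right) (B := S.right)).toRingHom := by
    ext x
    exact (((Algebra.TensorProduct.includeRight
      (R := R.right) (A := R'.right) (B := S.right)).commutes x).symm)
  refine ⟨Under.mk (R'.hom ≫ CommRingCat.ofHom
      (algebraMap R'.right (TensorProduct R.right R'.right S.right))),
    Under.homMk (CommRingCat.ofHom (algebraMap _ _)) rfl,
    Under.homMk (CommRingCat.ofHom (Algebra.TensorProduct.includeRight
      (R := R.right) (A := R'.right) (B := S.right)).toRingHom) ?_, ⟨?_, ?_⟩, ?_⟩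
  · have h1 := Under.w f
    have h2 := Under.w g
    change S.hom ≫ _ = R'.hom ≫ _
    rw [← h1, ← h2, Category.assoc, Category.assoc, key]
  · exact (RingHom.etale_algebraMap (R := R'.right)
      (S := TensorProduct R.right R'.right S.right)).mpr inferInstance
  · exact (RingHom.faithfullyFlat_algebraMap_iff (R := R'.right)
      (S := TensorProduct R.right R'.right S.right)).mpr inferInstance
  · exact Under.UnderMorphism.ext key

theorem IsEtaleCover.injective {k : Type u} [CommRing k] {R S : AlgOver k} {f : R ⟶ S}
    (hf : IsEtaleCover f) : Function.Injective f.right.hom :=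
  hf.2.injective

/-- Descent of functions along an étale covering. -/
theorem IsEtaleCover.descend {k : Type u} [CommRing k] {R S : AlgOver k} {f : R ⟶ S}
    (hf : IsEtaleCover f) (x : S.right)
    (h : ∀ (S' : AlgOver k) (i j : S ⟶ S'), f ≫ i = f ≫ j → i.right.hom x = j.right.hom x) :
    ∃ y : R.right, f.right.hom y = x := by
  let _ := f.right.hom.toAlgebra
  have _ : Module.FaithfullyFlat R.right S.right := hf.2
  have key : f.right ≫ CommRingCat.ofHom
        (algebraMap S.right (TensorProduct R.right S.right S.right)) =
      f.right ≫ CommRingCat.ofHom (Algebra.TensorProduct.includeRight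
        (R := R.right) (A := S.right) (B := S.right)).toRingHom := by
    ext x
    exact (((Algebra.TensorProduct.includeRight
      (R := R.right) (A := S.right) (B := S.right)).commutes x).symm)
  have h1 := Under.w f
  let S' : AlgOver k := Under.mk (S.hom ≫ CommRingCat.ofHom
    (algebraMap S.right (TensorProduct R.right S.right S.right)))
  let i : S ⟶ S' := Under.homMk (CommRingCat.ofHom (algebraMap _ _)) rfl
  let j : S ⟶ S' := Under.homMk (CommRingCat.ofHom (Algebra.TensorProduct.includeRight
      (R := R.right) (A := S.right) (B := S.right)).toRingHom) (by
    change S.hom ≫ _ = S.hom ≫ _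
    rw [← h1, Category.assoc, Category.assoc, key])
  have e := h S' i j (Under.UnderMorphism.ext key)
  have e' : Algebra.TensorProduct.includeLeftSubRight R.right S.right x = 0 := by
    rw [Algebra.TensorProduct.includeLeftSubRight_apply, sub_eq_zero]
    exact e
  exact (Algebra.IsEffective.of_faithfullyFlat R.right S.right x).mp e'

/-- Two `R`-points of `P` are `r`-related étale locally on `R`. -/
def LocRel {k : Type u} [CommRing k] {P : AlgOver k ⥤ Type w}
    (r : ∀ R : AlgOver k, P.obj R → P.obj R → Prop) {R : AlgOver k} (p q : P.obj R) : Prop :=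
  ∃ (S : AlgOver k) (f : R ⟶ S), IsEtaleCover f ∧ r S (P.map f p) (P.map f q)

/-- A section over `R` of the quotient sheaf `P / r` for the étale topology, where `r` is an
equivalence relation on the sheaf `P`: an equivalence class, that is, a subsheaf of `P` over `R`
which is stable under `r`, any two sections of which are `r`-related étale locally, and which has
a section étale locally on `R`. -/
@[ext]
structure QuotientSection {k : Type u} [CommRing k] (P : AlgOver k ⥤ Type w)
    (r : ∀ R : AlgOver k, P.obj R → P.obj R → Prop) (R : AlgOver k) where
  /-- the points of the class over each `R`-algebra `S` -/
  carrier : ∀ S : AlgOver k, (R ⟶ S) → Set (P.obj S)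
  map_mem : ∀ (S S' : AlgOver k) (f : R ⟶ S) (g : S ⟶ S') (p : P.obj S),
    p ∈ carrier S f → P.map g p ∈ carrier S' (f ≫ g)
  mem_of_cover : ∀ (S S' : AlgOver k) (f : R ⟶ S) (g : S ⟶ S') (p : P.obj S),
    IsEtaleCover g → P.map g p ∈ carrier S' (f ≫ g) → p ∈ carrier S f
  mem_of_rel : ∀ (S : AlgOver k) (f : R ⟶ S) (p q : P.obj S),
    p ∈ carrier S f → r S p q → q ∈ carrier S f
  locRel : ∀ (S : AlgOver k) (f : R ⟶ S) (p q : P.obj S),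
    p ∈ carrier S f → q ∈ carrier S f → LocRel r p q
  exists_cover : ∃ (S : AlgOver k) (f : R ⟶ S), IsEtaleCover f ∧ (carrier S f).Nonempty

/-- Restriction of a section of the quotient sheaf along `R ⟶ R'`. -/
def QuotientSection.restrict {k : Type u} [CommRing k] {P : AlgOver k ⥤ Type w}
    {r : ∀ R : AlgOver k, P.obj R → P.obj R → Prop} {R R' : AlgOver k} (h : R ⟶ R')
    (Z : QuotientSection P r R) : QuotientSection P r R' where
  carrier S f := Z.carrier S (h ≫ f)
  map_mem S S' f g p hp := by
    rw [← Category.assoc]; exact Z.map_mem S S' (h ≫ f) g p hp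
  mem_of_cover S S' f g p hg hp := by
    rw [← Category.assoc] at hp; exact Z.mem_of_cover S S' (h ≫ f) g p hg hp
  mem_of_rel S f p q hp hr := Z.mem_of_rel S (h ≫ f) p q hp hr
  locRel S f p q hp hq := Z.locRel S (h ≫ f) p q hp hq
  exists_cover := by
    obtain ⟨S, f, hf, p, hp⟩ := Z.exists_cover
    obtain ⟨S', f', g', hf', e⟩ := hf.baseChange h
    exact ⟨S', f', hf', P.map g' p, by rw [e]; exact Z.map_mem S S' f g' p hp⟩

/-- The quotient sheaf `P / r` for the étale topology. -/
def quotientSheaf {k : Type u} [CommRing k] (P : AlgOver k ⥤ Type w)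
    (r : ∀ R : AlgOver k, P.obj R → P.obj R → Prop) : AlgOver k ⥤ Type (max (u + 1) w) where
  obj R := QuotientSection P r R
  map h := ↾(QuotientSection.restrict h)
  map_id R := by
    refine ConcreteCategory.hom_ext _ _ fun Z => ?_
    refine QuotientSection.ext ?_
    funext S f
    change Z.carrier S (𝟙 R ≫ f) = Z.carrier S f
    rw [Category.id_comp]
  map_comp h h' := by
    refine ConcreteCategory.hom_ext _ _ fun Z => ?_
    refine QuotientSection.ext ?_
    funext S f
    change Z.carrier S ((h ≫ h') ≫ f) = Z.carrier S (h ≫ h' ≫ f)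
    rw [Category.assoc]

/-! ### The projective line with its action of `GL(2)` -/

/-- The punctured plane `𝔸² ∖ {0}`: pairs of elements that generate the unit ideal. -/
def puncturedPlane (k : Type u) [CommRing k] : AlgOver k ⥤ Type u where
  obj R := {v : Fin 2 → R.right // ∃ w : Fin 2 → R.right, w 0 * v 0 + w 1 * v 1 = 1}
  map f := ↾fun v => ⟨fun i => f.right.hom (v.1 i), by
    obtain ⟨w, hw⟩ := v.2
    exact ⟨fun i => f.right.hom (w i), by rw [← map_mul, ← map_mul, ← map_add, hw, map_one]⟩⟩
  map_id R := ConcreteCategory.hom_ext _ _ fun _ => Subtype.ext rfl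
  map_comp f g := ConcreteCategory.hom_ext _ _ fun _ => Subtype.ext rfl

/-- Proportionality: `v` and `v'` are in the same orbit of `𝔾ₘ`. -/
def proportional (k : Type u) [CommRing k] (R : AlgOver k) (v v' : (puncturedPlane k).obj R) :
    Prop :=
  ∃ c : R.rightˣ, v'.1 = fun i => (c : R.right) * v.1 i

/-- The projective line `ℙ¹ = (𝔸² ∖ {0}) / 𝔾ₘ` over `k`. -/
def projLine (k : Type u) [CommRing k] : AlgOver k ⥤ Type (u + 1) :=
  quotientSheaf (puncturedPlane k) (proportional k)

/-- The standard linear action of `GL(2)` on `𝔸² ∖ {0}`. -/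
def planeAct {k : Type u} [CommRing k] {R : AlgOver k} (g : GL (Fin 2) R.right)
    (v : (puncturedPlane k).obj R) : (puncturedPlane k).obj R :=
  ⟨(g : Matrix (Fin 2) (Fin 2) R.right).mulVec v.1, by
    obtain ⟨w, hw⟩ := v.2
    refine ⟨Matrix.vecMul w ((g⁻¹ : GL (Fin 2) R.right) : Matrix (Fin 2) (Fin 2) R.right), ?_⟩
    have h := Matrix.dotProduct_mulVec
      (Matrix.vecMul w ((g⁻¹ : GL (Fin 2) R.right) : Matrix (Fin 2) (Fin 2) R.right))
      (g : Matrix (Fin 2) (Fin 2) R.right) v.1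
    rw [Matrix.vecMul_vecMul, ← Units.val_mul, inv_mul_cancel, Units.val_one,
      Matrix.vecMul_one] at h
    simp only [dotProduct, Fin.sum_univ_two] at h
    rw [h, hw]⟩

theorem planeAct_map {k : Type u} [CommRing k] {R S : AlgOver k} (f : R ⟶ S)
    (g : GL (Fin 2) R.right) (v : (puncturedPlane k).obj R) :
    (puncturedPlane k).map f (planeAct g v) =
      planeAct (Matrix.GeneralLinearGroup.map f.right.hom g) ((puncturedPlane k).map f v) := by
  refine Subtype.ext (funext fun i => ?_)
  change f.right.hom ((g : Matrix (Fin 2) (Fin 2) R.right).mulVec v.1 i) =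
    (((g : Matrix (Fin 2) (Fin 2) R.right).map f.right.hom).mulVec
      (fun j => f.right.hom (v.1 j))) i
  simp only [Matrix.mulVec, dotProduct, Fin.sum_univ_two, map_add, map_mul, Matrix.map_apply]

theorem planeAct_proportional {k : Type u} [CommRing k] {R : AlgOver k}
    (g : GL (Fin 2) R.right) (v v' : (puncturedPlane k).obj R) (h : proportional k R v v') :
    proportional k R (planeAct g v) (planeAct g v') := by
  obtain ⟨c, hc⟩ := h
  refine ⟨c, funext fun i => ?_⟩
  change (g : Matrix (Fin 2) (Fin 2) R.right).mulVec v'.1 i =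
    c * (g : Matrix (Fin 2) (Fin 2) R.right).mulVec v.1 i
  rw [hc]
  simp only [Matrix.mulVec, dotProduct, Fin.sum_univ_two]
  ring

theorem planeAct_inv_act {k : Type u} [CommRing k] {R : AlgOver k}
    (g : GL (Fin 2) R.right) (v : (puncturedPlane k).obj R) :
    planeAct g (planeAct g⁻¹ v) = v := by
  refine Subtype.ext ?_
  change (g : Matrix (Fin 2) (Fin 2) R.right).mulVec
    (((g⁻¹ : GL (Fin 2) R.right) : Matrix (Fin 2) (Fin 2) R.right).mulVec v.1) = v.1
  rw [Matrix.mulVec_mulVec, ← Units.val_mul, mul_inv_cancel, Units.val_one, Matrix.one_mulVec]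

theorem planeAct_act_inv {k : Type u} [CommRing k] {R : AlgOver k}
    (g : GL (Fin 2) R.right) (v : (puncturedPlane k).obj R) :
    planeAct g⁻¹ (planeAct g v) = v := by
  have := planeAct_inv_act g⁻¹ v
  rwa [inv_inv] at this

/-- The left action of `GL(2)` (through `PGL(2)`) on `ℙ¹`: the class `gL` consists of the `v` such
that `g⁻¹ v` is in the class `L`. -/
def lineAct {k : Type u} [CommRing k] {R : AlgOver k} (g : GL (Fin 2) R.right)
    (L : (projLine k).obj R) : (projLine k).obj R where
  carrier S f := {v | planeAct (Matrix.GeneralLinearGroup.map f.right.hom g)⁻¹ v ∈ L.carrier S f}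
  map_mem S S' f h v hv := by
    have := L.map_mem S S' f h _ hv
    rw [planeAct_map, map_inv] at this
    exact this
  mem_of_cover S S' f h v hh hv := by
    refine L.mem_of_cover S S' f h _ hh ?_
    rw [planeAct_map, map_inv]
    exact hv
  mem_of_rel S f v v' hv hr :=
    L.mem_of_rel S f _ _ hv (planeAct_proportional _ v v' hr)
  locRel S f v v' hv hv' := by
    obtain ⟨S', h, hh, hr⟩ := L.locRel S f _ _ hv hv'
    refine ⟨S', h, hh, ?_⟩
    rw [planeAct_map, planeAct_map, map_inv] at hr
    have := planeAct_proportional (Matrix.GeneralLinearGroup.map h.right.hom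
      (Matrix.GeneralLinearGroup.map f.right.hom g)) _ _ hr
    rwa [planeAct_inv_act, planeAct_inv_act] at this
  exists_cover := by
    obtain ⟨S, f, hf, v, hv⟩ := L.exists_cover
    refine ⟨S, f, hf, planeAct (Matrix.GeneralLinearGroup.map f.right.hom g) v, ?_⟩
    change planeAct _⁻¹ (planeAct _ v) ∈ L.carrier S f
    rwa [planeAct_act_inv]

/-! ### The torsor `𝒯 ⟶ V` and the conic bundle `X ⟶ V` -/

/-- `F(s,t,u) = s² + t² + u² - stu - 4`. -/
def cayley {R : Type u} [CommRing R] (s t u : R) : R :=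
  s ^ 2 + t ^ 2 + u ^ 2 - s * t * u - 4

theorem cayley_map {R S : Type u} [CommRing R] [CommRing S] (f : R →+* S) (s t u : R) :
    f (cayley s t u) = cayley (f s) (f t) (f u) := by
  simp only [cayley, map_sub, map_add, map_mul, map_pow, map_ofNat]

/-- `V = 𝔸³ ∖ M₀`, the complement of the Cayley cubic `F(s,t,u) = 0`. -/
def traceSpace (k : Type u) [CommRing k] : AlgOver k ⥤ Type u where
  obj R := {p : R.right × R.right × R.right // IsUnit (cayley p.1 p.2.1 p.2.2)}
  map f := ↾fun p => ⟨(f.right.hom p.1.1, f.right.hom p.1.2.1, f.right.hom p.1.2.2), by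
    rw [← cayley_map]; exact p.2.map f.right.hom⟩
  map_id R := ConcreteCategory.hom_ext _ _ fun _ => Subtype.ext rfl
  map_comp f g := ConcreteCategory.hom_ext _ _ fun _ => Subtype.ext rfl

/-- The traces `(tr A, tr B, tr AB)` of a pair of matrices in `SL(2)`. -/
def traces {R : Type u} [CommRing R]
    (p : Matrix.SpecialLinearGroup (Fin 2) R × Matrix.SpecialLinearGroup (Fin 2) R) : R × R × R :=
  (p.1.1.trace, p.2.1.trace, (p.1.1 * p.2.1).trace)

theorem traces_map {R S : Type u} [CommRing R] [CommRing S] (f : R →+* S)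
    (p : Matrix.SpecialLinearGroup (Fin 2) R × Matrix.SpecialLinearGroup (Fin 2) R) :
    traces (Matrix.SpecialLinearGroup.map f p.1, Matrix.SpecialLinearGroup.map f p.2) =
      (f (traces p).1, f (traces p).2.1, f (traces p).2.2) := by
  simp [traces, Matrix.trace_fin_two, Matrix.mul_apply, Fin.sum_univ_two]

/-- `𝒯 = f⁻¹(V) ⊂ SL(2) × SL(2)`, where `f(A,B) = (tr A, tr B, tr AB)`. -/
def torsor (k : Type u) [CommRing k] : AlgOver k ⥤ Type u where
  obj R := {p : Matrix.SpecialLinearGroup (Fin 2) R.right ×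
      Matrix.SpecialLinearGroup (Fin 2) R.right //
    IsUnit (cayley (traces p).1 (traces p).2.1 (traces p).2.2)}
  map f := ↾fun p => ⟨(Matrix.SpecialLinearGroup.map f.right.hom p.1.1,
      Matrix.SpecialLinearGroup.map f.right.hom p.1.2), by
    rw [traces_map, ← cayley_map]; exact p.2.map f.right.hom⟩
  map_id R := ConcreteCategory.hom_ext _ _ fun _ => Subtype.ext rfl
  map_comp f g := ConcreteCategory.hom_ext _ _ fun _ => Subtype.ext rfl

/-- The morphism `f : 𝒯 ⟶ V` on points. -/
def torsorTraces {k : Type u} [CommRing k] {R : AlgOver k} (p : (torsor k).obj R) :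
    (traceSpace k).obj R := ⟨traces p.1, p.2⟩

theorem torsorTraces_map {k : Type u} [CommRing k] {R S : AlgOver k} (f : R ⟶ S)
    (p : (torsor k).obj R) :
    torsorTraces ((torsor k).map f p) = (traceSpace k).map f (torsorTraces p) :=
  Subtype.ext (traces_map f.right.hom p.1)

/-- The functor of points of `𝒯 × ℙ¹`. -/
def torsorProdLine (k : Type u) [CommRing k] : AlgOver k ⥤ Type (u + 1) where
  obj R := (torsor k).obj R × (projLine k).obj R
  map f := ↾fun p => ((torsor k).map f p.1, (projLine k).map f p.2)
  map_id R := by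
    refine ConcreteCategory.hom_ext _ _ fun p => ?_
    exact Prod.ext (ConcreteCategory.congr_hom ((torsor k).map_id R) p.1)
      (ConcreteCategory.congr_hom ((projLine k).map_id R) p.2)
  map_comp f g := by
    refine ConcreteCategory.hom_ext _ _ fun p => ?_
    exact Prod.ext (ConcreteCategory.congr_hom ((torsor k).map_comp f g) p.1)
      (ConcreteCategory.congr_hom ((projLine k).map_comp f g) p.2)

/-- Two points of `𝒯 × ℙ¹` are in the same orbit of the diagonal action of `PGL(2)`, by simultaneous
conjugation on `𝒯` and by the standard action on `ℙ¹`. Both actions are written as actions of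
`GL(2)`; as `GL(2) ⟶ PGL(2)` is an epimorphism of étale sheaves, this gives the same
quotient sheaf. -/
def sameOrbit (k : Type u) [CommRing k] (R : AlgOver k) (p q : (torsorProdLine k).obj R) : Prop :=
  ∃ g : GL (Fin 2) R.right,
    q.1.1.1.1 = g.1 * p.1.1.1.1 * (g⁻¹).1 ∧ q.1.1.2.1 = g.1 * p.1.1.2.1 * (g⁻¹).1 ∧
      q.2 = lineAct g p.2

/-- `X = (𝒯 × ℙ¹) / PGL(2)`. -/
def conicBundle (k : Type u) [CommRing k] : AlgOver k ⥤ Type (u + 1) :=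
  quotientSheaf (torsorProdLine k) (sameOrbit k)

theorem sameOrbit.traces_eq {k : Type u} [CommRing k] {R : AlgOver k}
    {p q : (torsorProdLine k).obj R} (h : sameOrbit k R p q) :
    torsorTraces p.1 = torsorTraces q.1 := by
  obtain ⟨g, hA, hB, -⟩ := h
  have hg : (g⁻¹).1 * g.1 = 1 := by rw [← Units.val_mul, inv_mul_cancel, Units.val_one]
  have conj : ∀ M : Matrix (Fin 2) (Fin 2) R.right,
      (g.1 * M * (g⁻¹).1).trace = M.trace := fun M => by
    rw [Matrix.trace_mul_comm, ← Matrix.mul_assoc, hg, Matrix.one_mul]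
  refine Subtype.ext (Prod.ext ?_ (Prod.ext ?_ ?_))
  · change p.1.1.1.1.trace = q.1.1.1.1.trace
    rw [hA, conj]
  · change p.1.1.2.1.trace = q.1.1.2.1.trace
    rw [hB, conj]
  · change (p.1.1.1.1 * p.1.1.2.1).trace = (q.1.1.1.1 * q.1.1.2.1).trace
    rw [hA, hB, ← conj (p.1.1.1.1 * p.1.1.2.1)]
    congr 1
    simp only [Matrix.mul_assoc]
    rw [← Matrix.mul_assoc (g⁻¹).1 g.1, hg, Matrix.one_mul]

/-- The point `v` of `V` is the image of the section `Z` of `X`: every point `((A, B), L)` of the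
class `Z` has traces `v`. -/
def LiesOver {k : Type u} [CommRing k] {R : AlgOver k} (Z : (conicBundle k).obj R)
    (v : (traceSpace k).obj R) : Prop :=
  ∀ (S : AlgOver k) (f : R ⟶ S) (p : (torsorProdLine k).obj S), p ∈ Z.carrier S f →
    torsorTraces p.1 = (traceSpace k).map f v

theorem traceSpace_map_injective {k : Type u} [CommRing k] {R S : AlgOver k} {f : R ⟶ S}
    (hf : IsEtaleCover f) : Function.Injective ((traceSpace k).map f) := by
  intro v v' h
  have h' := congrArg Subtype.val h
  exact Subtype.ext (Prod.ext (hf.injective (congrArg Prod.fst h'))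
    (Prod.ext (hf.injective (congrArg (fun q => q.2.1) h'))
      (hf.injective (congrArg (fun q => q.2.2) h'))))

theorem traces_eq_of_mem {k : Type u} [CommRing k] {R S : AlgOver k} {f : R ⟶ S}
    (Z : (conicBundle k).obj R) {p q : (torsorProdLine k).obj S} (hp : p ∈ Z.carrier S f)
    (hq : q ∈ Z.carrier S f) : torsorTraces p.1 = torsorTraces q.1 := by
  obtain ⟨S', g, hg, hr⟩ := Z.locRel S f p q hp hq
  refine traceSpace_map_injective hg ?_
  rw [← torsorTraces_map, ← torsorTraces_map]
  exact hr.traces_eq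

theorem exists_liesOver {k : Type u} [CommRing k] {R : AlgOver k} (Z : (conicBundle k).obj R) :
    ∃ v : (traceSpace k).obj R, LiesOver Z v := by
  obtain ⟨S, f, hf, p, hp⟩ := Z.exists_cover
  have main : ∀ (S' : AlgOver k) (i j : S ⟶ S'), f ≫ i = f ≫ j →
      (traceSpace k).map i (torsorTraces p.1) = (traceSpace k).map j (torsorTraces p.1) := by
    intro S' i j hij
    have hi := Z.map_mem S S' f i p hp
    have hj := Z.map_mem S S' f j p hp
    rw [← hij] at hj
    have := traces_eq_of_mem Z hi hj
    rw [← torsorTraces_map, ← torsorTraces_map]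
    exact this
  obtain ⟨a, ha⟩ := hf.descend (torsorTraces p.1).1.1 fun S' i j hij =>
    congrArg (fun q => q.1.1) (main S' i j hij)
  obtain ⟨b, hb⟩ := hf.descend (torsorTraces p.1).1.2.1 fun S' i j hij =>
    congrArg (fun q => q.1.2.1) (main S' i j hij)
  obtain ⟨c, hc⟩ := hf.descend (torsorTraces p.1).1.2.2 fun S' i j hij =>
    congrArg (fun q => q.1.2.2) (main S' i j hij)
  have hF : f.right.hom (cayley a b c) = cayley (torsorTraces p.1).1.1 (torsorTraces p.1).1.2.1
      (torsorTraces p.1).1.2.2 := by rw [cayley_map, ha, hb, hc]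
  obtain ⟨y, hy⟩ := (torsorTraces p.1).2.exists_right_inv
  rw [← hF] at hy
  obtain ⟨d, hd⟩ := hf.descend y fun S' i j hij => by
    have e : ∀ x : R.right, i.right.hom (f.right.hom x) = j.right.hom (f.right.hom x) := fun x =>
      congrArg (fun q : R ⟶ S' => q.right.hom x) hij
    have h1 := congrArg i.right.hom hy
    have h2 := congrArg j.right.hom hy
    rw [map_mul, map_one] at h1 h2
    rw [← e] at h2
    exact (left_inv_eq_right_inv ((mul_comm _ _).trans h1) h2)
  have hu : IsUnit (cayley a b c) := by
    refine IsUnit.of_mul_eq_one d (hf.injective ?_)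
    rw [map_mul, hd, hy, map_one]
  obtain ⟨v, hv⟩ : ∃ v : (traceSpace k).obj R, (traceSpace k).map f v = torsorTraces p.1 :=
    ⟨⟨(a, b, c), hu⟩, Subtype.ext (Prod.ext ha (Prod.ext hb hc))⟩
  refine ⟨v, fun S' g q hq => ?_⟩
  obtain ⟨S'', f', g', hf', e⟩ := hf.baseChange g
  have h1 := Z.map_mem S' S'' g f' q hq
  have h2 := Z.map_mem S S'' f g' p hp
  rw [← e] at h2
  have h3 := traces_eq_of_mem Z h1 h2
  refine traceSpace_map_injective hf' ?_
  rw [← torsorTraces_map]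
  refine h3.trans ((torsorTraces_map g' p.1).trans ?_)
  rw [← hv, ← Functor.map_comp_apply, ← Functor.map_comp_apply, e]

/-- The morphism `X ⟶ V` on points, induced by `f : 𝒯 ⟶ V`. -/
def bundleProj {k : Type u} [CommRing k] {R : AlgOver k} (Z : (conicBundle k).obj R) :
    (traceSpace k).obj R :=
  (exists_liesOver Z).choose

theorem bundleProj_eq_iff {k : Type u} [CommRing k] {R : AlgOver k} (Z : (conicBundle k).obj R)
    (v : (traceSpace k).obj R) : bundleProj Z = v ↔ LiesOver Z v := by
  have h0 : LiesOver Z (bundleProj Z) := (exists_liesOver Z).choose_spec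
  refine ⟨fun h => h ▸ h0, fun h => ?_⟩
  obtain ⟨S, f, hf, p, hp⟩ := Z.exists_cover
  exact traceSpace_map_injective hf ((h0 S f p hp).symm.trans (h S f p hp))

theorem bundleProj_map {k : Type u} [CommRing k] {R R' : AlgOver k} (h : R ⟶ R')
    (Z : (conicBundle k).obj R) :
    bundleProj ((conicBundle k).map h Z) = (traceSpace k).map h (bundleProj Z) := by
  rw [bundleProj_eq_iff]
  intro S f p hp
  rw [← Functor.map_comp_apply]
  exact (bundleProj_eq_iff Z _).mp rfl S (h ≫ f) p hp

/-! ### The generic fibre -/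

/-- `K = k(s,t,u)`, the function field of `𝔸³`. -/
abbrev FunField (k : Type u) [Field k] : Type u := FractionRing (MvPolynomial (Fin 3) k)

/-- The coordinate functions `s`, `t`, `u` (for `i = 0, 1, 2`) in `K`. -/
def coord (k : Type u) [Field k] (i : Fin 3) : FunField k :=
  algebraMap (MvPolynomial (Fin 3) k) (FunField k) (MvPolynomial.X i)

theorem cayley_coord_ne_zero (k : Type u) [Field k] [CharZero k] :
    cayley (coord k 0) (coord k 1) (coord k 2) ≠ 0 := by
  unfold coord
  rw [← cayley_map]
  refine (map_ne_zero_iff _ (IsFractionRing.injective _ _)).mpr fun h => ?_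
  have := congrArg (MvPolynomial.eval (fun _ => (0 : k))) h
  rw [cayley_map] at this
  simp [cayley] at this

theorem coord_sq_sub_four_ne_zero (k : Type u) [Field k] [CharZero k] :
    coord k 1 ^ 2 - 4 ≠ 0 := by
  have e : coord k 1 ^ 2 - 4 = algebraMap (MvPolynomial (Fin 3) k) (FunField k)
      (MvPolynomial.X 1 ^ 2 - 4) := by
    simp only [coord, map_sub, map_pow, map_ofNat]
  rw [e]
  refine (map_ne_zero_iff _ (IsFractionRing.injective _ _)).mpr fun h => ?_
  have := congrArg (MvPolynomial.eval (fun _ => (0 : k))) h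
  simp only [map_sub, map_pow, map_ofNat, MvPolynomial.eval_X, map_zero] at this
  norm_num at this

/-- For an extension `K` of `k`, a `K`-algebra regarded as a `k`-algebra. -/
abbrev restrictBase (k K : Type u) [CommRing k] [CommRing K] [Algebra k K] :
    AlgOver K ⥤ AlgOver k :=
  Under.map (CommRingCat.ofHom (algebraMap k K))

/-- The generic point `(s,t,u)` of `V`, as a point over a given `K`-algebra `R`. -/
def genericPoint (k : Type u) [Field k] [CharZero k] (R : AlgOver (FunField k)) :
    (traceSpace k).obj ((restrictBase k (FunField k)).obj R) :=
  ⟨(R.hom.hom (coord k 0), R.hom.hom (coord k 1), R.hom.hom (coord k 2)), by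
    have := ((cayley_coord_ne_zero k).isUnit).map R.hom.hom
    rwa [cayley_map] at this⟩

theorem genericPoint_map (k : Type u) [Field k] [CharZero k] {R R' : AlgOver (FunField k)}
    (f : R ⟶ R') :
    (traceSpace k).map ((restrictBase k (FunField k)).map f) (genericPoint k R) =
      genericPoint k R' := by
  have h : ∀ x : FunField k, f.right.hom (R.hom.hom x) = R'.hom.hom x := fun x =>
    congrArg (fun q : CommRingCat.of (FunField k) ⟶ R'.right => q.hom x) (Under.w f)
  exact Subtype.ext (Prod.ext (h _) (Prod.ext (h _) (h _)))

/-- The generic fibre `X_K = X ×_V Spec K` of `X ⟶ V`. -/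
def genericFibre (k : Type u) [Field k] [CharZero k] : AlgOver (FunField k) ⥤ Type (u + 1) where
  obj R := {Z : (conicBundle k).obj ((restrictBase k (FunField k)).obj R) //
    bundleProj Z = genericPoint k R}
  map f := ↾fun Z => ⟨(conicBundle k).map ((restrictBase k (FunField k)).map f) Z.1, by
    rw [bundleProj_map, Z.2, genericPoint_map]⟩
  map_id R := ConcreteCategory.hom_ext _ _ fun Z => Subtype.ext (by
    change (conicBundle k).map ((restrictBase k (FunField k)).map (𝟙 R)) Z.1 = Z.1
    rw [CategoryTheory.Functor.map_id, CategoryTheory.Functor.map_id]; rfl)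
  map_comp f g := ConcreteCategory.hom_ext _ _ fun Z => Subtype.ext (by
    change (conicBundle k).map ((restrictBase k (FunField k)).map (f ≫ g)) Z.1 = _
    rw [Functor.map_comp, Functor.map_comp]; rfl)

/-! ### Galois cohomology with coefficients in `μ₂` -/

/-- The group `μ₂` of square roots of unity in an algebraic closure of `K`. -/
abbrev MuTwo (K : Type u) [Field K] : Type u := rootsOfUnity 2 (AlgebraicClosure K)

/-- The action of the absolute Galois group on `μ₂`. -/
def galMu {K : Type u} [Field K] (σ : Gal(AlgebraicClosure K/K)) : MuTwo K →* MuTwo K :=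
  restrictRootsOfUnity σ 2

/-- Continuous (that is, locally constant) 2-cocycles of the absolute Galois group of `K` with
values in `μ₂`. -/
def twoCocycles (K : Type u) [Field K] :
    Subgroup (Gal(AlgebraicClosure K/K) × Gal(AlgebraicClosure K/K) → MuTwo K) where
  carrier := {a | IsLocallyConstant a ∧ ∀ σ τ ρ,
    galMu σ (a (τ, ρ)) * a (σ, τ * ρ) = a (σ * τ, ρ) * a (σ, τ)}
  one_mem' := ⟨IsLocallyConstant.const 1, fun σ τ ρ => by simp⟩
  mul_mem' {a b} ha hb := ⟨ha.1.mul hb.1, fun σ τ ρ => by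
    simp only [Pi.mul_apply, map_mul]
    rw [mul_mul_mul_comm, ha.2, hb.2, mul_mul_mul_comm]⟩
  inv_mem' {a} ha := ⟨ha.1.inv, fun σ τ ρ => by
    simp only [Pi.inv_apply, map_inv]
    rw [← mul_inv, ha.2, mul_inv]⟩

/-- Coboundaries of locally constant 1-cochains. -/
def twoCoboundaries (K : Type u) [Field K] :
    Subgroup (Gal(AlgebraicClosure K/K) × Gal(AlgebraicClosure K/K) → MuTwo K) where
  carrier := {a | ∃ b : Gal(AlgebraicClosure K/K) → MuTwo K, IsLocallyConstant b ∧
    ∀ σ τ, a (σ, τ) = galMu σ (b τ) * (b (σ * τ))⁻¹ * b σ}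
  one_mem' := ⟨1, IsLocallyConstant.const 1, fun σ τ => by simp⟩
  mul_mem' := by
    rintro a a' ⟨b, hb, h⟩ ⟨b', hb', h'⟩
    refine ⟨b * b', hb.mul hb', fun σ τ => ?_⟩
    simp only [Pi.mul_apply, map_mul, h, h', mul_inv]
    rw [mul_mul_mul_comm, mul_mul_mul_comm (galMu σ (b τ))]
  inv_mem' := by
    rintro a ⟨b, hb, h⟩
    refine ⟨b⁻¹, hb.inv, fun σ τ => ?_⟩
    simp only [Pi.inv_apply, map_inv, h, mul_inv]

/-- The Galois cohomology group `H²(K, μ₂)` (written multiplicatively). -/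
abbrev H2 (K : Type u) [Field K] : Type u :=
  twoCocycles K ⧸ (twoCoboundaries K).subgroupOf (twoCocycles K)

theorem exists_sqrt {K : Type u} [Field K] (a : Kˣ) :
    ∃ α : (AlgebraicClosure K)ˣ, (α : AlgebraicClosure K) ^ 2 = algebraMap K _ a := by
  obtain ⟨α, h⟩ := IsAlgClosed.exists_pow_nat_eq (algebraMap K (AlgebraicClosure K) a) two_pos
  have h0 : α ≠ 0 := by
    rintro rfl
    have : algebraMap K (AlgebraicClosure K) a ≠ 0 := by simp
    exact this (by rw [← h]; simp)
  exact ⟨Units.mk0 α h0, h⟩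

/-- A square root of `a` in the algebraic closure. -/
def sqrtUnit {K : Type u} [Field K] (a : Kˣ) : (AlgebraicClosure K)ˣ := (exists_sqrt a).choose

theorem sqrtUnit_sq {K : Type u} [Field K] (a : Kˣ) :
    (sqrtUnit a : AlgebraicClosure K) ^ 2 = algebraMap K _ a := (exists_sqrt a).choose_spec

/-- The Kummer cocycle `σ ↦ σ(√a) / √a` of `a`, with values in `μ₂`. -/
def kummer {K : Type u} [Field K] (a : Kˣ) (σ : Gal(AlgebraicClosure K/K)) : MuTwo K :=
  ⟨Units.map (σ : AlgebraicClosure K →* AlgebraicClosure K) (sqrtUnit a) * (sqrtUnit a)⁻¹, by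
    rw [mem_rootsOfUnity, mul_pow, inv_pow, mul_inv_eq_one]
    ext
    simp only [Units.val_pow_eq_pow_val, Units.coe_map, MonoidHom.coe_coe]
    rw [← map_pow, sqrtUnit_sq, AlgEquiv.commutes]⟩

open Classical in
/-- The pairing `μ₂ × μ₂ ⟶ μ₂` that identifies `μ₂ ⊗ μ₂` with `μ₂`: it sends `(-1, -1)` to `-1` and
`(1, y)` and `(x, 1)` to `1`. -/
def muPairing {K : Type u} [Field K] (x y : MuTwo K) : MuTwo K := if x = 1 then 1 else y

theorem muTwo_mul_self {K : Type u} [Field K] (x : MuTwo K) : x * x = 1 := by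
  have h := (mem_rootsOfUnity 2 _).mp x.2
  exact Subtype.ext (by rw [Subgroup.coe_mul, ← pow_two]; exact h)

theorem muTwo_eq_or {K : Type u} [Field K] (x : MuTwo K) :
    x = 1 ∨ ((x : (AlgebraicClosure K)ˣ) : AlgebraicClosure K) = -1 := by
  have h := congrArg (fun y : MuTwo K => ((y : (AlgebraicClosure K)ˣ) : AlgebraicClosure K))
    (muTwo_mul_self x)
  rcases mul_self_eq_one_iff.mp (show ((x : (AlgebraicClosure K)ˣ) : AlgebraicClosure K) *
    ((x : (AlgebraicClosure K)ˣ) : AlgebraicClosure K) = 1 from h) with h | h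
  · exact Or.inl (Subtype.ext (Units.ext h))
  · exact Or.inr h

theorem galMu_apply {K : Type u} [Field K] (σ : Gal(AlgebraicClosure K/K)) (x : MuTwo K) :
    galMu σ x = x := by
  rcases muTwo_eq_or x with rfl | h
  · exact map_one _
  · refine Subtype.ext (Units.ext ?_)
    change σ ((x : (AlgebraicClosure K)ˣ) : AlgebraicClosure K) = _
    rw [h, map_neg, map_one]

theorem muPairing_mul_right {K : Type u} [Field K] (x y y' : MuTwo K) :
    muPairing x (y * y') = muPairing x y * muPairing x y' := by
  unfold muPairing
  split_ifs <;> simp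

theorem muPairing_mul_left {K : Type u} [Field K] (x x' y : MuTwo K) :
    muPairing (x * x') y = muPairing x y * muPairing x' y := by
  have key : x ≠ 1 → x' ≠ 1 → x * x' = 1 := fun h h' => by
    have e := (muTwo_eq_or x).resolve_left h
    have e' := (muTwo_eq_or x').resolve_left h'
    refine Subtype.ext (Units.ext ?_)
    change ((x : (AlgebraicClosure K)ˣ) : AlgebraicClosure K) *
      ((x' : (AlgebraicClosure K)ˣ) : AlgebraicClosure K) = 1
    rw [e, e']; ring
  by_cases h : x = 1
  · rw [h, one_mul, show muPairing 1 y = 1 from if_pos rfl, one_mul]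
  · by_cases h' : x' = 1
    · simp [muPairing, h, h']
    · simp [muPairing, h, h', key h h', muTwo_mul_self]

theorem kummer_mul {K : Type u} [Field K] (a : Kˣ) (σ τ : Gal(AlgebraicClosure K/K)) :
    kummer a (σ * τ) = kummer a σ * kummer a τ := by
  conv_rhs => rw [← galMu_apply σ (kummer a τ)]
  refine Subtype.ext (Units.ext ?_)
  change σ (τ (sqrtUnit a : AlgebraicClosure K)) * (((sqrtUnit a)⁻¹ : (AlgebraicClosure K)ˣ) :
      AlgebraicClosure K) =
    σ (sqrtUnit a : AlgebraicClosure K) * (((sqrtUnit a)⁻¹ : (AlgebraicClosure K)ˣ) :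
      AlgebraicClosure K) *
    σ (τ (sqrtUnit a : AlgebraicClosure K) * (((sqrtUnit a)⁻¹ : (AlgebraicClosure K)ˣ) :
      AlgebraicClosure K))
  have h : σ (sqrtUnit a : AlgebraicClosure K) *
      σ (((sqrtUnit a)⁻¹ : (AlgebraicClosure K)ˣ) : AlgebraicClosure K) = 1 := by
    rw [← map_mul, Units.mul_inv, map_one]
  rw [map_mul]
  linear_combination (-(σ (τ (sqrtUnit a : AlgebraicClosure K)) *
    (((sqrtUnit a)⁻¹ : (AlgebraicClosure K)ˣ) : AlgebraicClosure K))) * h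

theorem kummer_isLocallyConstant {K : Type u} [Field K] (a : Kˣ) :
    IsLocallyConstant (kummer a) := by
  rw [IsLocallyConstant.iff_exists_open]
  intro σ
  have ho := stabilizer_isOpen_of_isIntegral (K := K) (sqrtUnit a : AlgebraicClosure K)
  refine ⟨(fun τ => σ⁻¹ * τ) ⁻¹' (MulAction.stabilizer Gal(AlgebraicClosure K/K)
    (sqrtUnit a : AlgebraicClosure K) : Set Gal(AlgebraicClosure K/K)),
    ho.preimage (continuous_const_mul σ⁻¹), ?_, fun τ hτ => ?_⟩
  · change σ⁻¹ * σ ∈ MulAction.stabilizer _ _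
    rw [inv_mul_cancel]; exact one_mem _
  · have h1 : kummer a (σ⁻¹ * τ) = 1 := by
      refine Subtype.ext (Units.ext ?_)
      change (σ⁻¹ * τ) (sqrtUnit a : AlgebraicClosure K) *
        (((sqrtUnit a)⁻¹ : (AlgebraicClosure K)ˣ) : AlgebraicClosure K) = 1
      rw [show (σ⁻¹ * τ) (sqrtUnit a : AlgebraicClosure K) = (sqrtUnit a : AlgebraicClosure K)
        from hτ, Units.mul_inv]
    have h2 := kummer_mul a σ (σ⁻¹ * τ)
    rwa [mul_inv_cancel_left, h1, mul_one] at h2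

/-- The quaternion symbol `(a, b) ∈ H²(K, μ₂)`: the cup product
`(σ, τ) ↦ χ_a(σ) ⊗ σ(χ_b(τ))` of the Kummer classes of `a` and `b`. -/
def symbol {K : Type u} [Field K] (a b : Kˣ) : H2 K :=
  QuotientGroup.mk ⟨fun p => muPairing (kummer a p.1) (galMu p.1 (kummer b p.2)), by
    refine ⟨?_, fun σ τ ρ => ?_⟩
    · simp only [galMu_apply]
      exact ((kummer_isLocallyConstant a).comp_continuous continuous_fst).comp₂
        ((kummer_isLocallyConstant b).comp_continuous continuous_snd) muPairing
    · simp only [galMu_apply, kummer_mul, muPairing_mul_left, muPairing_mul_right]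
      rw [mul_comm, mul_right_comm, mul_comm (muPairing (kummer a σ) (kummer b τ)),
        mul_right_comm]
      ac_rfl⟩

/-! ### The class of a Severi–Brauer curve -/

/-- The algebraic closure of `K` as an algebra over `K`. -/
abbrev closurePt (K : Type u) [Field K] : AlgOver K :=
  (restrictBase K (AlgebraicClosure K)).obj (Under.mk (𝟙 (CommRingCat.of (AlgebraicClosure K))))

/-- An element of the absolute Galois group as a morphism of `K`-algebras. -/
def galHom {K : Type u} [Field K] (σ : Gal(AlgebraicClosure K/K)) : closurePt K ⟶ closurePt K :=
  Under.homMk (CommRingCat.ofHom (σ : AlgebraicClosure K →+* AlgebraicClosure K)) (by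
    ext x
    exact σ.commutes x)

/-- For a field `K` of characteristic zero, `c ∈ H²(K, μ₂)` is the class `[Y]` of the form `Y` of
`ℙ¹` (a smooth projective conic) over `K`: there is an isomorphism
`φ : ℙ¹ ⟶ Y` over the algebraic closure `K̄`, and a continuous lift `g : Gal ⟶ SL(2, K̄)` of the
1-cocycle `σ ↦ φ⁻¹ ∘ σ(φ)` of `Y` with values in `PGL(2, K̄) = Aut(ℙ¹)`, such that `c` is
the class of the 2-cocycle `(σ, τ) ↦ g(σ) σ(g(τ)) g(στ)⁻¹`, that is, the image of the class of `Y`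
under the connecting map `H¹(K, PGL(2)) ⟶ H²(K, μ₂)` of `1 ⟶ μ₂ ⟶ SL(2) ⟶ PGL(2) ⟶ 1`.
The equality `σ(φ) = φ ∘ g(σ)` is expressed on `K̄`-points, as `σ(φ(L)) = φ(g(σ) σ(L))`. -/
def HasBrauerClass {K : Type u} [Field K] (Y : AlgOver K ⥤ Type (u + 1)) (c : H2 K) : Prop :=
  ∃ (φ : restrictBase K (AlgebraicClosure K) ⋙ projLine K ≅
        restrictBase K (AlgebraicClosure K) ⋙ Y)
    (g : Gal(AlgebraicClosure K/K) → Matrix.SpecialLinearGroup (Fin 2) (AlgebraicClosure K))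
    (a : twoCocycles K),
    IsLocallyConstant g ∧
    (∀ (σ : Gal(AlgebraicClosure K/K)) (L : (projLine K).obj (closurePt K)),
      Y.map (galHom σ) (φ.hom.app (Under.mk (𝟙 (CommRingCat.of (AlgebraicClosure K)))) L) =
        φ.hom.app (Under.mk (𝟙 (CommRingCat.of (AlgebraicClosure K))))
          (lineAct (R := closurePt K) (Matrix.SpecialLinearGroup.toGL (g σ))
            ((projLine K).map (galHom σ) L))) ∧
    (∀ σ τ : Gal(AlgebraicClosure K/K),
      (g σ * Matrix.SpecialLinearGroup.map (σ : AlgebraicClosure K →+* AlgebraicClosure K)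
          (g τ)).1 =
        ((a.1 (σ, τ) : (AlgebraicClosure K)ˣ) : AlgebraicClosure K) • (g (σ * τ)).1) ∧
    c = QuotientGroup.mk a

end

end TraceConic

namespace TraceConic

open CategoryTheory

noncomputable section

/-! ### Étale coverings -/

/-! Write α = √(t² - 4) and β = √F in the algebraic closure of K. Since α ≠ 0, a matrix B of trace t
and determinant 1 can be taken diagonal, with eigenvalues l, m = (t ± α)/2. The conditions tr A = s
and tr AB = u then fix the diagonal of A, and det A = 1 fixes the product of its off-diagonal
entries as -F/(t² - 4). Scaling the upper entry to 1 makes the lower one -(β/α)², which is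
invertible. This is the generic normal pair.

Over the algebraic closure, L ↦ [(A, B), L] is an isomorphism from ℙ¹ to the fibre of X
(`trivializationApp_bijective`). It is injective because the centralizer of a normal pair consists
of scalars (`fibrePoint_injective`). It is surjective because any pair with the same traces is étale
locally conjugate to the normal one (`exists_cover_conj`); over a ring this rests on two explicit
intertwiners whose determinants generate the unit ideal (`IsNormalPair.span_det_intertwiner`).

The cocycle of X_K therefore measures how σ moves (A, B). If σ fixes α, the pair is fixed and g(σ) =
1. If σ(α) = -α, the two diagonal entries of each matrix are exchanged, and the pair is conjugated
back by g(σ) = yJ, where J has rows (0, α/β), (-β/α, 0) and y = σ(β)/β (`genericPair_conj`). The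
factor y = ±1 does not affect the class in PGL(2), but with it g(σ)σ(g(τ))g(στ)⁻¹ equals on the nose
the cup product cocycle of the Kummer characters of t² - 4 and F (`cocycleLift_mul`). No coboundary
has to be adjusted. -/

theorem IsEtaleCover.id {k : Type u} [CommRing k] (R : AlgOver k) : IsEtaleCover (𝟙 R) :=
  ⟨RingHom.Etale.of_bijective Function.bijective_id,
    RingHom.FaithfullyFlat.of_bijective Function.bijective_id⟩

theorem IsEtaleCover.comp {k : Type u} [CommRing k] {R S T : AlgOver k} {f : R ⟶ S} {g : S ⟶ T}
    (hf : IsEtaleCover f) (hg : IsEtaleCover g) : IsEtaleCover (f ≫ g) :=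
  ⟨RingHom.Etale.stableUnderComposition _ _ hf.1 hg.1,
    RingHom.FaithfullyFlat.stableUnderComposition _ _ hf.2 hg.2⟩

/-- Finitely many elements that generate the unit ideal define a covering by the product of the
localizations. -/
theorem exists_etaleCover_of_span_eq_top {k : Type u} [CommRing k] {R : AlgOver k} {n : ℕ}
    (d : Fin n → R.right) (hd : Ideal.span (Set.range d) = ⊤) :
    ∃ (S : AlgOver k) (f : R ⟶ S) (e : S.right ≅ CommRingCat.of (∀ i, Localization.Away (d i))),
      IsEtaleCover f ∧ ∀ x i, e.hom.hom (f.right.hom x) i = algebraMap _ _ x := by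
  have : ∀ i, Algebra.Etale R.right (Localization.Away (d i)) := fun i =>
    Algebra.Etale.of_isLocalizationAway (d i)
  have hE : Algebra.Etale R.right (∀ i, Localization.Away (d i)) := inferInstance
  have hF : Module.FaithfullyFlat R.right (∀ i, Localization.Away (d i)) := by
    have : Module.Flat R.right (∀ i, Localization.Away (d i)) := inferInstance
    refine Module.FaithfullyFlat.of_comap_surjective fun P => ?_
    -- A prime containing every `d i` would contain 1; so `P` lies in some basic open set `D(d i)`
    -- and comes from the `i`-th factor.
    obtain ⟨i, hi⟩ : ∃ i, d i ∉ P.asIdeal := by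
      by_contra! h
      refine P.2.ne_top (top_le_iff.mp (hd ▸ Ideal.span_le.mpr ?_))
      rintro _ ⟨i, rfl⟩
      exact h i
    have : P ∈ Set.range (PrimeSpectrum.comap (algebraMap R.right (Localization.Away (d i)))) := by
      rw [PrimeSpectrum.localization_away_comap_range _ (d i)]
      exact hi
    obtain ⟨Q, rfl⟩ := this
    exact ⟨PrimeSpectrum.comap (Pi.evalRingHom _ i) Q, rfl⟩
  refine ⟨Under.mk (R.hom ≫ CommRingCat.ofHom
      (algebraMap R.right (∀ i, Localization.Away (d i)))),
    Under.homMk (CommRingCat.ofHom (algebraMap _ _)) rfl, Iso.refl _, ⟨?_, ?_⟩, fun x i => rfl⟩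
  · exact RingHom.etale_algebraMap.mpr hE
  · exact RingHom.faithfullyFlat_algebraMap_iff.mpr hF

/-! ### Sections of quotient sheaves -/

/-- A relation on the points of `P` that is an equivalence relation compatible with restriction. -/
structure IsEquivRel {k : Type u} [CommRing k] (P : AlgOver k ⥤ Type w)
    (r : ∀ R : AlgOver k, P.obj R → P.obj R → Prop) : Prop where
  equiv : ∀ R, Equivalence (r R)
  map : ∀ {R S : AlgOver k} (f : R ⟶ S) {p q : P.obj R}, r R p q → r S (P.map f p) (P.map f q)

section

variable {k : Type u} [CommRing k] {P : AlgOver k ⥤ Type w}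
  {r : ∀ R : AlgOver k, P.obj R → P.obj R → Prop}

theorem LocRel.of_rel {R : AlgOver k} {p q : P.obj R} (h : r R p q) : LocRel r p q :=
  ⟨R, 𝟙 R, .id R, by simpa using h⟩

theorem LocRel.symm (hr : IsEquivRel P r) {R : AlgOver k} {p q : P.obj R} (h : LocRel r p q) :
    LocRel r q p := by
  obtain ⟨S, f, hf, h⟩ := h
  exact ⟨S, f, hf, (hr.equiv S).symm h⟩

theorem LocRel.map (hr : IsEquivRel P r) {R S : AlgOver k} (f : R ⟶ S) {p q : P.obj R}
    (h : LocRel r p q) : LocRel r (P.map f p) (P.map f q) := by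
  obtain ⟨S', g, hg, h⟩ := h
  obtain ⟨T, g', f', hg', e⟩ := hg.baseChange f
  refine ⟨T, g', hg', ?_⟩
  rw [← Functor.map_comp_apply, ← Functor.map_comp_apply, e, Functor.map_comp_apply,
    Functor.map_comp_apply]
  exact hr.map f' h

theorem LocRel.of_cover {R S : AlgOver k} {f : R ⟶ S} (hf : IsEtaleCover f) {p q : P.obj R}
    (h : LocRel r (P.map f p) (P.map f q)) : LocRel r p q := by
  obtain ⟨T, g, hg, h⟩ := h
  refine ⟨T, f ≫ g, hf.comp hg, ?_⟩
  rwa [Functor.map_comp_apply, Functor.map_comp_apply]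

theorem LocRel.trans (hr : IsEquivRel P r) {R : AlgOver k} {p q q' : P.obj R} (h : LocRel r p q)
    (hq : LocRel r q q') : LocRel r p q' := by
  obtain ⟨S, f, hf, h⟩ := h
  obtain ⟨T, g, hg, hq⟩ := hq.map hr f
  refine .of_cover (hf.comp hg) (.of_rel ?_)
  rw [Functor.map_comp_apply, Functor.map_comp_apply]
  exact (hr.equiv T).trans (hr.map g h) hq

/-- The class of a point of `P` in the quotient sheaf `P / r`. -/
def QuotientSection.mk' (hr : IsEquivRel P r) {R : AlgOver k} (p : P.obj R) :
    QuotientSection P r R where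
  carrier S f := {q | LocRel r (P.map f p) q}
  map_mem S S' f g q hq := by
    simpa only [Set.mem_ofPred_eq, Functor.map_comp_apply] using LocRel.map hr g hq
  mem_of_cover S S' f g q hg hq := by
    simp only [Set.mem_ofPred_eq, Functor.map_comp_apply] at hq
    exact hq.of_cover hg
  mem_of_rel S f q q' hq h := LocRel.trans hr hq (.of_rel h)
  locRel S f q q' hq hq' := (LocRel.symm hr hq).trans hr hq'
  exists_cover := ⟨R, 𝟙 R, .id R, P.map (𝟙 R) p, .of_rel ((hr.equiv R).refl _)⟩

theorem QuotientSection.mem_of_locRel {R : AlgOver k} (Z : QuotientSection P r R) {S : AlgOver k}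
    {f : R ⟶ S} {p q : P.obj S} (hp : p ∈ Z.carrier S f) (h : LocRel r p q) :
    q ∈ Z.carrier S f := by
  obtain ⟨T, g, hg, h⟩ := h
  exact Z.mem_of_cover S T f g q hg (Z.mem_of_rel _ _ _ _ (Z.map_mem S T f g p hp) h)

/-- Two classes that have a point in common over a covering are equal. -/
theorem QuotientSection.eq_of_mem {R : AlgOver k} {Z Z' : QuotientSection P r R} {S : AlgOver k}
    {f : R ⟶ S} (hf : IsEtaleCover f) {p : P.obj S} (hp : p ∈ Z.carrier S f)
    (hp' : p ∈ Z'.carrier S f) : Z = Z' := by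
  have main : ∀ {Z Z' : QuotientSection P r R}, p ∈ Z.carrier S f → p ∈ Z'.carrier S f →
      ∀ (T : AlgOver k) (g : R ⟶ T), Z.carrier T g ⊆ Z'.carrier T g := by
    intro Z Z' hp hp' T g q hq
    -- Over a common covering of `T` that also receives `S`, both `q` and the restriction of `p` lie
    -- in `Z`, hence are locally related; as `p` also lies in `Z'`, so does `q`, and this descends
    -- to `T`.
    obtain ⟨T', f', g', hf', e⟩ := hf.baseChange g
    refine Z'.mem_of_cover T T' g f' q hf' ?_
    have h1 := Z.map_mem T T' g f' q hq
    have h2 := Z.map_mem S T' f g' p hp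
    have h3 := Z'.map_mem S T' f g' p hp'
    rw [← e] at h2 h3
    exact Z'.mem_of_locRel h3 (Z.locRel _ _ _ _ h2 h1)
  exact QuotientSection.ext (funext fun T => funext fun g =>
    (main hp hp' T g).antisymm (main hp' hp T g))

theorem QuotientSection.mem_mk' (hr : IsEquivRel P r) {R : AlgOver k} (p : P.obj R) :
    p ∈ (QuotientSection.mk' hr p).carrier R (𝟙 R) :=
  .of_rel (by rw [Functor.map_id_apply]; exact (hr.equiv R).refl p)

theorem QuotientSection.mk'_eq_iff (hr : IsEquivRel P r) {R : AlgOver k} (p : P.obj R)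
    (Z : QuotientSection P r R) : .mk' hr p = Z ↔ p ∈ Z.carrier R (𝟙 R) :=
  ⟨fun h => h ▸ mem_mk' hr p, fun h => eq_of_mem (.id R) (mem_mk' hr p) h⟩

theorem QuotientSection.mk'_eq_mk'_iff (hr : IsEquivRel P r) {R : AlgOver k} (p q : P.obj R) :
    mk' hr p = mk' hr q ↔ LocRel r q p := by
  rw [mk'_eq_iff]
  change LocRel r (P.map (𝟙 R) q) p ↔ _
  rw [Functor.map_id_apply]

theorem QuotientSection.restrict_mk' (hr : IsEquivRel P r) {R S : AlgOver k} (f : R ⟶ S)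
    (p : P.obj R) : (mk' hr p).restrict f = mk' hr (P.map f p) := by
  refine QuotientSection.ext (funext fun T => funext fun g => ?_)
  change {q | LocRel r (P.map (f ≫ g) p) q} = {q | LocRel r (P.map g (P.map f p)) q}
  rw [Functor.map_comp_apply]

/-- Separatedness of the quotient sheaf: classes that agree over a covering share a point over a
finer one. -/
theorem QuotientSection.restrict_injective {R S : AlgOver k} {f : R ⟶ S}
    (hf : IsEtaleCover f) :
    Function.Injective (QuotientSection.restrict f : QuotientSection P r R → _) := by
  intro Z Z' h
  obtain ⟨T, g, hg, p, hp⟩ := (Z.restrict f).exists_cover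
  exact eq_of_mem (hf.comp hg) hp (h ▸ hp : p ∈ (Z'.restrict f).carrier T g)

end

/-! ### The action on the projective line -/

theorem isEquivRel_proportional (k : Type u) [CommRing k] :
    IsEquivRel (puncturedPlane k) (proportional k) where
  equiv R :=
    { refl := fun v => ⟨1, by simp⟩
      symm := by
        rintro v v' ⟨c, hc⟩
        exact ⟨c⁻¹, by simp [hc]⟩
      trans := by
        rintro v v' v'' ⟨c, hc⟩ ⟨c', hc'⟩
        exact ⟨c' * c, by simp [hc, hc', mul_assoc]⟩ }
  map := by
    rintro R S f v v' ⟨c, hc⟩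
    refine ⟨c.map f.right.hom, funext fun i => ?_⟩
    change f.right.hom (v'.1 i) = f.right.hom c * f.right.hom (v.1 i)
    rw [hc, map_mul]

section

variable {k : Type u} [CommRing k] {R S : AlgOver k}

theorem planeAct_one (v : (puncturedPlane k).obj R) : planeAct 1 v = v :=
  Subtype.ext (by simp [planeAct])

theorem planeAct_mul (g h : GL (Fin 2) R.right) (v : (puncturedPlane k).obj R) :
    planeAct (g * h) v = planeAct g (planeAct h v) :=
  Subtype.ext (Matrix.mulVec_mulVec v.1 g.1 h.1).symm

theorem lineAct_one (L : (projLine k).obj R) : lineAct 1 L = L := by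
  refine QuotientSection.ext (funext fun S => funext fun f => Set.ext fun v => ?_)
  change planeAct _⁻¹ v ∈ L.carrier S f ↔ _
  rw [map_one, inv_one, planeAct_one]

theorem lineAct_mul (g h : GL (Fin 2) R.right) (L : (projLine k).obj R) :
    lineAct (g * h) L = lineAct g (lineAct h L) := by
  refine QuotientSection.ext (funext fun S => funext fun f => Set.ext fun v => ?_)
  change planeAct _⁻¹ v ∈ L.carrier S f ↔ planeAct _⁻¹ (planeAct _⁻¹ v) ∈ L.carrier S f
  rw [map_mul, mul_inv_rev, planeAct_mul]

theorem lineAct_map (f : R ⟶ S) (g : GL (Fin 2) R.right) (L : (projLine k).obj R) :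
    (projLine k).map f (lineAct g L) =
      lineAct (Matrix.GeneralLinearGroup.map f.right.hom g) ((projLine k).map f L) :=
  QuotientSection.ext (funext fun _ => funext fun _ => rfl)

/-- Scalar matrices act trivially on `ℙ¹`. -/
theorem lineAct_of_scalar (g : GL (Fin 2) R.right) (c : R.right)
    (hg : g.1 = Matrix.scalar (Fin 2) c) (L : (projLine k).obj R) : lineAct g L = L := by
  have hc : IsUnit c := by
    have h := (Matrix.isUnit_iff_isUnit_det _).mp g.isUnit
    rw [hg] at h
    simp at h
    exact h
  obtain ⟨c, rfl⟩ := hc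
  obtain ⟨S, f, hf, v, hv⟩ := L.exists_cover
  refine QuotientSection.eq_of_mem hf
    (p := planeAct (Matrix.GeneralLinearGroup.map f.right.hom g) v) ?_
    (L.mem_of_rel S f v _ hv ⟨c.map f.right.hom, funext fun i => ?_⟩)
  · change planeAct _⁻¹ (planeAct _ v) ∈ L.carrier S f
    rwa [planeAct_act_inv]
  · change (g.1.map f.right.hom).mulVec v.1 i = f.right.hom c * v.1 i
    rw [hg]
    fin_cases i <;> simp [Matrix.mulVec, dotProduct]

theorem isEquivRel_sameOrbit (k : Type u) [CommRing k] :
    IsEquivRel (torsorProdLine k) (sameOrbit k) where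
  equiv R :=
    { refl := fun p => ⟨1, by simp, by simp, (lineAct_one _).symm⟩
      symm := by
        rintro p q ⟨g, hA, hB, hL⟩
        have h1 : (g⁻¹).1 * g.1 = 1 := by rw [← Units.val_mul, inv_mul_cancel, Units.val_one]
        have h2 : ∀ M : Matrix (Fin 2) (Fin 2) R.right,
            M = (g⁻¹).1 * (g.1 * M * (g⁻¹).1) * g.1 := fun M => by
          rw [Matrix.mul_assoc, Matrix.mul_assoc, h1, Matrix.mul_one, ← Matrix.mul_assoc, h1,
            Matrix.one_mul]
        refine ⟨g⁻¹, ?_, ?_, ?_⟩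
        · rw [hA, inv_inv]; exact h2 _
        · rw [hB, inv_inv]; exact h2 _
        · rw [hL, ← lineAct_mul, inv_mul_cancel, lineAct_one]
      trans := by
        rintro p q q' ⟨g, hA, hB, hL⟩ ⟨h, hA', hB', hL'⟩
        refine ⟨h * g, ?_, ?_, ?_⟩
        · rw [hA', hA, mul_inv_rev]; simp only [Units.val_mul, Matrix.mul_assoc]
        · rw [hB', hB, mul_inv_rev]; simp only [Units.val_mul, Matrix.mul_assoc]
        · rw [hL', hL, lineAct_mul] }
  map := by
    rintro R S f p q ⟨g, hA, hB, hL⟩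
    have key : ∀ M N : Matrix (Fin 2) (Fin 2) R.right, N = g.1 * M * (g⁻¹).1 →
        N.map f.right.hom = (Matrix.GeneralLinearGroup.map f.right.hom g).1 * M.map f.right.hom *
          ((Matrix.GeneralLinearGroup.map f.right.hom g)⁻¹).1 := by
      rintro M N rfl
      rw [Matrix.map_mul, Matrix.map_mul, ← map_inv]
      rfl
    refine ⟨Matrix.GeneralLinearGroup.map f.right.hom g, key _ _ hA, key _ _ hB, ?_⟩
    change (projLine k).map f q.2 = _
    rw [hL, lineAct_map]
    rfl

end

/-! ### Conjugation of pairs of matrices with given traces -/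

/-- The pair `(A, B)` of matrices in `SL(2)`, with `B` diagonal with distinct eigenvalues `l`, `m`
and `A` with off-diagonal entries `1` and `c`, where `c` is invertible. -/
structure IsNormalPair {R : Type u} [CommRing R] (A B : Matrix (Fin 2) (Fin 2) R)
    (a c d l m : R) : Prop where
  left : A = !![a, 1; c, d]
  right : B = !![l, 0; 0, m]
  isUnit_sub : IsUnit (l - m)
  isUnit : IsUnit c

theorem IsNormalPair.map {R S : Type u} [CommRing R] [CommRing S]
    {A B : Matrix (Fin 2) (Fin 2) R} {a c d l m : R} (h : IsNormalPair A B a c d l m)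
    (f : R →+* S) : IsNormalPair (A.map f) (B.map f) (f a) (f c) (f d) (f l) (f m) where
  left := by rw [h.left]; ext i j; fin_cases i <;> fin_cases j <;> simp
  right := by rw [h.right]; ext i j; fin_cases i <;> fin_cases j <;> simp
  isUnit_sub := by rw [← map_sub]; exact h.isUnit_sub.map f
  isUnit := h.isUnit.map f

/-- The pair `(A, B)` has only scalars as centralizer. -/
theorem IsNormalPair.eq_scalar_of_commute {R : Type u} [CommRing R]
    {A B : Matrix (Fin 2) (Fin 2) R} {a c d l m : R} (h : IsNormalPair A B a c d l m)
    {g : Matrix (Fin 2) (Fin 2) R} (hA : g * A = A * g) (hB : g * B = B * g) :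
    g = Matrix.scalar (Fin 2) (g 0 0) := by
  obtain ⟨rfl, rfl, hu, -⟩ := h
  have e1 := congrFun (congrFun hB 0) 1
  have e2 := congrFun (congrFun hB 1) 0
  have e3 := congrFun (congrFun hA 0) 1
  simp [Matrix.mul_apply, Fin.sum_univ_two] at e1 e2 e3
  -- Commuting with the diagonal `B` multiplies the off-diagonal entries of `g` by ±(l - m), a unit,
  -- so they vanish. The entry 1 of `A` then forces the two diagonal entries of `g` to agree.
  have h1 : g 0 1 = 0 := hu.mul_left_cancel (by linear_combination -e1)
  have h2 : g 1 0 = 0 := hu.mul_left_cancel (by linear_combination e2)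
  rw [h1] at e3
  ext i j
  fin_cases i <;> fin_cases j <;> simp [h1, h2]
  linear_combination -e3

/-- A matrix that intertwines the normal pair `(A, B)` and the pair `(A', B')` with the same traces:
its columns are the multiples `c v` and `(A' - a) v` of eigenvectors of `B'`, where `v` is the
`i`-th column of `B' - m`. -/
def intertwiner {R : Type u} [CommRing R] (A' B' : Matrix (Fin 2) (Fin 2) R) (a c m : R)
    (i : Fin 2) : Matrix (Fin 2) (Fin 2) R :=
  let v : Fin 2 → R := fun j => (B' - Matrix.scalar (Fin 2) m) j i
  Matrix.of fun j => ![c * v j, (A' - Matrix.scalar (Fin 2) a).mulVec v j]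

section

variable {R : Type u} [CommRing R] {A B A' B' : Matrix (Fin 2) (Fin 2) R} {a c d l m : R}

/-- On the first column the identity is formal, because `A` sends e₁ to a e₁ + c e₂. On the second
it says (A' - d)(A' - a)v = cv, which is Cayley–Hamilton for `A'`, as a + d = tr A' and ad - c = 1 =
det A'. -/
theorem IsNormalPair.intertwiner_mul_left (h : IsNormalPair A B a c d l m) (hA : A.det = 1)
    (hA' : A'.det = 1) (htA : A.trace = A'.trace) (i : Fin 2) :
    intertwiner A' B' a c m i * A = A' * intertwiner A' B' a c m i := by
  obtain ⟨rfl, rfl, -, -⟩ := h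
  simp only [Matrix.det_fin_two, Matrix.trace_fin_two, Matrix.of_apply, Matrix.cons_val',
    Matrix.cons_val_zero, Matrix.cons_val_one, Matrix.cons_val_fin_one] at hA hA' htA
  ext j k
  fin_cases i <;> fin_cases j <;> fin_cases k <;>
    simp [intertwiner, Matrix.mul_apply, Fin.sum_univ_two, Matrix.mulVec, dotProduct] <;>
    grind

/-- The first column is an eigenvector for l because (B' - l)(B' - m) = 0. The second is one for m
because P = B' - m has determinant zero, so PXP = tr(PX)P for every X, and the trace hypotheses give
tr(P(A' - a)) = 0. -/
theorem IsNormalPair.intertwiner_mul_right (h : IsNormalPair A B a c d l m)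
    (hB : B.det = 1) (hB' : B'.det = 1) (htA : A.trace = A'.trace)
    (htB : B.trace = B'.trace) (htAB : (A * B).trace = (A' * B').trace) (i : Fin 2) :
    intertwiner A' B' a c m i * B = B' * intertwiner A' B' a c m i := by
  obtain ⟨rfl, rfl, -, -⟩ := h
  simp [Matrix.det_fin_two, Matrix.trace_fin_two, Matrix.mul_apply, Fin.sum_univ_two] at *
  ext j k
  fin_cases i <;> fin_cases j <;> fin_cases k <;>
    simp [intertwiner, Matrix.mul_apply, Fin.sum_univ_two, Matrix.mulVec, dotProduct] <;>
    grind

/-- Over a ring neither column of B' - m need give an invertible intertwiner, but the two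
determinants together generate the unit ideal. Up to sign and the unit c they are the off-diagonal
entries of the matrix N below, which has trace and determinant zero. -/
theorem IsNormalPair.span_det_intertwiner (h : IsNormalPair A B a c d l m) (hA : A.det = 1)
    (hA' : A'.det = 1) (hB : B.det = 1) (hB' : B'.det = 1) (htA : A.trace = A'.trace)
    (htB : B.trace = B'.trace) (htAB : (A * B).trace = (A' * B').trace) :
    Ideal.span (Set.range fun i => (intertwiner A' B' a c m i).det) = ⊤ := by
  obtain ⟨rfl, rfl, hu, hc⟩ := h
  let N := (B' - Matrix.scalar (Fin 2) l) * A' * (B' - Matrix.scalar (Fin 2) m)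
  -- By cyclicity tr N = tr(A'(B' - m)(B' - l)), which is zero by Cayley–Hamilton for `B'`.
  have htr : N 1 1 = - N 0 0 := by
    simp [N, Matrix.det_fin_two, Matrix.trace_fin_two, Matrix.mul_apply, Fin.sum_univ_two] at *
    grind
  have hdet : N.det = 0 := by
    have : (B' - Matrix.scalar (Fin 2) l).det = 0 := by
      simp [Matrix.det_fin_two, Matrix.trace_fin_two] at *
      linear_combination hB' - hB + l * htB
    rw [Matrix.det_mul, Matrix.det_mul, this, zero_mul, zero_mul]
  rw [Matrix.det_fin_two, htr] at hdet
  -- The right side is -tr(NA'). This trace depends only on the traces of the pair, so its value can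
  -- be read off from the normal pair.
  have hunit : (l - m) ^ 2 * c =
      - (N 0 0 * (A' 0 0 - A' 1 1) + N 0 1 * A' 1 0 + N 1 0 * A' 0 1) := by
    simp [N, Matrix.det_fin_two, Matrix.trace_fin_two, Matrix.mul_apply, Fin.sum_univ_two] at *
    grind
  have h0 : (intertwiner A' B' a c m 0).det = c * - N 1 0 := by
    simp [N, intertwiner, Matrix.det_fin_two, Matrix.trace_fin_two, Matrix.mul_apply,
      Fin.sum_univ_two, Matrix.mulVec, dotProduct] at *
    grind
  have h1 : (intertwiner A' B' a c m 1).det = c * N 0 1 := by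
    simp [N, intertwiner, Matrix.det_fin_two, Matrix.trace_fin_two, Matrix.mul_apply,
      Fin.sum_univ_two, Matrix.mulVec, dotProduct] at *
    grind
  generalize N 0 0 = n₀₀, N 0 1 = n₀₁, N 1 0 = n₁₀ at *
  set I := Ideal.span (Set.range fun i => (intertwiner A' B' a c m i).det)
  have m0 : -n₁₀ ∈ I := (Ideal.unit_mul_mem_iff_mem I hc).mp
    (h0 ▸ Ideal.subset_span (Set.mem_range_self (0 : Fin 2)))
  have m1 : n₀₁ ∈ I := (Ideal.unit_mul_mem_iff_mem I hc).mp
    (h1 ▸ Ideal.subset_span (Set.mem_range_self (1 : Fin 2)))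
  refine Ideal.eq_top_of_isUnit_mem I (x := ((l - m) ^ 2 * c) ^ 2) ?_ (((hu.pow 2).mul hc).pow 2)
  generalize (l - m) ^ 2 * c = z at *
  -- Modulo the off-diagonal entries of N, the unit z is -n₀₀ (A'₀₀ - A'₁₁), and det N = 0 reads
  -- n₀₀² = 0. So z² lies in the ideal; the coefficients make this explicit.
  have e : z ^ 2 = (A' 0 1 * (z - n₀₀ * (A' 0 0 - A' 1 1))) * (-n₁₀) +
      (-(A' 1 0) * (z - n₀₀ * (A' 0 0 - A' 1 1)) - n₁₀ * (A' 0 0 - A' 1 1) ^ 2) * n₀₁ := by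
    linear_combination (z - n₀₀ * (A' 0 0 - A' 1 1)) * hunit - (A' 0 0 - A' 1 1) ^ 2 * hdet
  rw [e]
  exact I.add_mem (I.mul_mem_left _ m0) (I.mul_mem_left _ m1)

end

/-! ### The fibres of the conic bundle -/

theorem QuotientSection.restrict_eq_mk' {k : Type u} [CommRing k] {P : AlgOver k ⥤ Type w}
    {r : ∀ R : AlgOver k, P.obj R → P.obj R → Prop} (hr : IsEquivRel P r) {R S : AlgOver k}
    (Z : QuotientSection P r R) {f : R ⟶ S} {p : P.obj S} (hp : p ∈ Z.carrier S f) :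
    Z.restrict f = mk' hr p := by
  refine ((mk'_eq_iff hr p _).mpr ?_).symm
  change p ∈ Z.carrier S (f ≫ 𝟙 S)
  rwa [Category.comp_id]

section

variable {k : Type u} [CommRing k] {R : AlgOver k}

/-- A pair of matrices is étale locally conjugate to a normal pair with the same traces. -/
theorem exists_cover_conj {T T' : (torsor k).obj R} {a c d l m : R.right}
    (hT : IsNormalPair T.1.1.1 T.1.2.1 a c d l m) (h : torsorTraces T = torsorTraces T') :
    ∃ (S : AlgOver k) (f : R ⟶ S), IsEtaleCover f ∧ ∃ g : GL (Fin 2) S.right,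
      ((torsor k).map f T').1.1.1 = g.1 * ((torsor k).map f T).1.1.1 * (g⁻¹).1 ∧
      ((torsor k).map f T').1.2.1 = g.1 * ((torsor k).map f T).1.2.1 * (g⁻¹).1 := by
  have h1 : T.1.1.1.trace = T'.1.1.1.trace := congrArg (fun p => p.1.1) h
  have h2 : T.1.2.1.trace = T'.1.2.1.trace := congrArg (fun p => p.1.2.1) h
  have h3 : (T.1.1.1 * T.1.2.1).trace = (T'.1.1.1 * T'.1.2.1).trace :=
    congrArg (fun p => p.1.2.2) h
  obtain ⟨S, f, e, hf, he⟩ := exists_etaleCover_of_span_eq_top _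
    (hT.span_det_intertwiner T.1.1.2 T'.1.1.2 T.1.2.2 T'.1.2.2 h1 h2 h3)
  have hinj : Function.Injective e.hom.hom := (ConcreteCategory.bijective_of_isIso e.hom).1
  have hsurj : Function.Surjective e.hom.hom := (ConcreteCategory.bijective_of_isIso e.hom).2
  -- The conjugating matrix over the product of localizations has the `i`-th intertwiner as its
  -- `i`-th component, so invertibility and the intertwining relations are checked factor by factor.
  let G := fun i => intertwiner T'.1.1.1 T'.1.2.1 a c m i
  have hG : ∀ j j', ∃ x : S.right, ∀ i, e.hom.hom x i = algebraMap _ _ (G i j j') := fun j j' => by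
    obtain ⟨x, hx⟩ := hsurj (fun i => algebraMap _ _ (G i j j'))
    exact ⟨x, fun i => by rw [hx]⟩
  choose g₀ hg₀ using hG
  have hdet : IsUnit (Matrix.of g₀).det := by
    have : IsUnit (e.hom.hom (Matrix.of g₀).det) := by
      rw [Pi.isUnit_iff]
      intro i
      have hi : e.hom.hom (Matrix.of g₀).det i = algebraMap _ _ (G i).det := by
        simp [Matrix.det_fin_two, hg₀]
      rw [hi]
      exact IsLocalization.Away.algebraMap_isUnit _
    have h' := this.map e.inv.hom
    rwa [← CommRingCat.comp_apply, e.hom_inv_id] at h'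
  have key : ∀ {M M' : Matrix (Fin 2) (Fin 2) R.right}, (∀ i, G i * M = M' * G i) →
      Matrix.of g₀ * M.map f.right.hom = M'.map f.right.hom * Matrix.of g₀ := by
    intro M M' hM
    ext j j'
    refine hinj (funext fun i => ?_)
    have := congrArg (algebraMap R.right (Localization.Away (G i).det))
      (congrFun (congrFun (hM i) j) j')
    simp only [Matrix.mul_apply, Fin.sum_univ_two, map_add, map_mul] at this
    simp only [Matrix.mul_apply, Fin.sum_univ_two, map_add, map_mul, Matrix.map_apply,
      Matrix.of_apply, Pi.add_apply, Pi.mul_apply, hg₀, he]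
    exact this
  let g : GL (Fin 2) S.right := Matrix.GeneralLinearGroup.mk'' (Matrix.of g₀) hdet
  have key' : ∀ {M M' : Matrix (Fin 2) (Fin 2) R.right}, (∀ i, G i * M = M' * G i) →
      M'.map f.right.hom = g.1 * M.map f.right.hom * (g⁻¹).1 := by
    intro M M' hM
    have hg : g.1 * M.map f.right.hom = M'.map f.right.hom * g.1 := key hM
    rw [hg, Matrix.mul_assoc, ← Units.val_mul, mul_inv_cancel, Units.val_one, Matrix.mul_one]
  exact ⟨S, f, hf, g, key' fun i => hT.intertwiner_mul_left T.1.1.2 T'.1.1.2 h1 i,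
    key' fun i => hT.intertwiner_mul_right T.1.2.2 T'.1.2.2 h1 h2 h3 i⟩

theorem IsNormalPair.torsor_map {T : (torsor k).obj R} {a c d l m : R.right}
    (hT : IsNormalPair T.1.1.1 T.1.2.1 a c d l m) {S : AlgOver k} (f : R ⟶ S) :
    IsNormalPair ((torsor k).map f T).1.1.1 ((torsor k).map f T).1.2.1 (f.right.hom a)
      (f.right.hom c) (f.right.hom d) (f.right.hom l) (f.right.hom m) :=
  hT.map f.right.hom

/-- The point of the fibre of `X` over the image of `T` given by a point of `ℙ¹`. -/
def fibrePoint (T : (torsor k).obj R) (L : (projLine k).obj R) : (conicBundle k).obj R :=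
  QuotientSection.mk' (isEquivRel_sameOrbit k) (T, L)

theorem fibrePoint_map (T : (torsor k).obj R) (L : (projLine k).obj R) {S : AlgOver k}
    (f : R ⟶ S) : (conicBundle k).map f (fibrePoint T L) =
      fibrePoint ((torsor k).map f T) ((projLine k).map f L) :=
  QuotientSection.restrict_mk' (isEquivRel_sameOrbit k) f (T, L)

theorem bundleProj_fibrePoint (T : (torsor k).obj R) (L : (projLine k).obj R) :
    bundleProj (fibrePoint T L) = torsorTraces T := by
  obtain ⟨v, hv⟩ := exists_liesOver (fibrePoint T L)
  have h := hv R (𝟙 R) (T, L) (QuotientSection.mem_mk' _ _)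
  rw [Functor.map_id_apply] at h
  rw [bundleProj_eq_iff, show torsorTraces T = v from h]
  exact hv

/-- Conjugation by `g` identifies the fibre points of conjugate pairs. -/
theorem fibrePoint_eq_of_conj {T T' : (torsor k).obj R} (g : GL (Fin 2) R.right)
    (hA : T'.1.1.1 = g.1 * T.1.1.1 * (g⁻¹).1) (hB : T'.1.2.1 = g.1 * T.1.2.1 * (g⁻¹).1)
    (L : (projLine k).obj R) : fibrePoint T L = fibrePoint T' (lineAct g L) :=
  (QuotientSection.mk'_eq_mk'_iff _ _ _).mpr
    (LocRel.symm (isEquivRel_sameOrbit k) (.of_rel ⟨g, hA, hB, rfl⟩))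

/-- If two points of ℙ¹ give the same class, then étale locally some g fixes the normal pair and
carries one to the other. Such a g is scalar and acts trivially on ℙ¹, so the points agree locally,
hence globally. -/
theorem fibrePoint_injective {T : (torsor k).obj R} {a c d l m : R.right}
    (hT : IsNormalPair T.1.1.1 T.1.2.1 a c d l m) : Function.Injective (fibrePoint T) := by
  intro L L' h
  obtain ⟨S, f, hf, g, hA, hB, hL⟩ := (QuotientSection.mk'_eq_mk'_iff _ _ _).mp h
  have comm : ∀ {M : Matrix (Fin 2) (Fin 2) S.right}, M = g.1 * M * (g⁻¹).1 →
      g.1 * M = M * g.1 := fun {M} hM => by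
    conv_rhs => rw [hM]
    rw [Matrix.mul_assoc _ (g⁻¹).1, ← Units.val_mul, inv_mul_cancel, Units.val_one,
      Matrix.mul_one]
  have hs := (hT.torsor_map f).eq_scalar_of_commute (comm hA) (comm hB)
  have hL' : (projLine k).map f L = lineAct g ((projLine k).map f L') := hL
  rw [lineAct_of_scalar g _ hs] at hL'
  exact QuotientSection.restrict_injective hf hL'

/-- The point of `ℙ¹` given by a point of the fibre of `X` over the image of a normal pair `T`. -/
def fibreLine {T : (torsor k).obj R} {a c d l m : R.right}
    (hT : IsNormalPair T.1.1.1 T.1.2.1 a c d l m) (Z : (conicBundle k).obj R)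
    (hZ : bundleProj Z = torsorTraces T) : (projLine k).obj R where
  carrier S f := {v | ((torsor k).map f T,
    QuotientSection.mk' (isEquivRel_proportional k) v) ∈ Z.carrier S f}
  map_mem S S' f g v hv := by
    have := Z.map_mem S S' f g _ hv
    change ((torsor k).map g ((torsor k).map f T), QuotientSection.restrict g _) ∈ _ at this
    rw [QuotientSection.restrict_mk', ← Functor.map_comp_apply] at this
    exact this
  mem_of_cover S S' f g v hg hv := by
    refine Z.mem_of_cover S S' f g _ hg ?_
    change ((torsor k).map g ((torsor k).map f T), QuotientSection.restrict g _) ∈ _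
    rw [QuotientSection.restrict_mk', ← Functor.map_comp_apply]
    exact hv
  mem_of_rel S f v v' hv h := by
    have : QuotientSection.mk' (isEquivRel_proportional k) v =
        QuotientSection.mk' (isEquivRel_proportional k) v' :=
      (QuotientSection.mk'_eq_mk'_iff _ _ _).mpr
        (LocRel.symm (isEquivRel_proportional k) (.of_rel h))
    change ((torsor k).map f T, QuotientSection.mk' (isEquivRel_proportional k) v') ∈ Z.carrier S f
    rw [← this]
    exact hv
  locRel S f v v' hv hv' := by
    -- Two vectors whose lines give the same fibre point over `T` span the same line, by the
    -- injectivity of `fibrePoint`.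
    refine (QuotientSection.mk'_eq_mk'_iff (isEquivRel_proportional k) _ _).mp ?_
    refine fibrePoint_injective (hT.torsor_map f) ?_
    exact (QuotientSection.mk'_eq_mk'_iff _ _ _).mpr (Z.locRel S f _ _ hv hv')
  exists_cover := by
    obtain ⟨S, f, hf, p, hp⟩ := Z.exists_cover
    have hp' := (bundleProj_eq_iff Z _).mp hZ S f p hp
    rw [← torsorTraces_map] at hp'
    -- A local representative (T', L) of `Z` has the traces of `T`, so after a further covering T' =
    -- gTg⁻¹, and (T, g⁻¹L) also represents `Z`.
    obtain ⟨S', f', hf', g, hA, hB⟩ := exists_cover_conj (hT.torsor_map f) hp'.symm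
    have hp'' := Z.map_mem S S' f f' p hp
    obtain ⟨S'', f'', hf'', v, hv⟩ := QuotientSection.exists_cover
      (lineAct g⁻¹ ((projLine k).map f' p.2))
    refine ⟨S'', (f ≫ f') ≫ f'', (hf.comp hf').comp hf'', v, ?_⟩
    have hmem : ((torsor k).map f' ((torsor k).map f T), lineAct g⁻¹ ((projLine k).map f' p.2)) ∈
        Z.carrier S' (f ≫ f') := by
      refine Z.mem_of_rel _ _ _ _ hp'' (((isEquivRel_sameOrbit k).equiv S').symm ?_)
      refine ⟨g, hA, hB, ?_⟩
      change (projLine k).map f' p.2 = lineAct g (lineAct g⁻¹ ((projLine k).map f' p.2))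
      rw [← lineAct_mul, mul_inv_cancel, lineAct_one]
    have hmem' := Z.map_mem _ S'' _ f'' _ hmem
    have e : (projLine k).map f'' (lineAct g⁻¹ ((projLine k).map f' p.2)) =
        QuotientSection.mk' (isEquivRel_proportional k) v :=
      QuotientSection.restrict_eq_mk' _ _ hv
    change ((torsor k).map ((f ≫ f') ≫ f'') T,
      QuotientSection.mk' (isEquivRel_proportional k) v) ∈ Z.carrier S'' ((f ≫ f') ≫ f'')
    rw [← e, Functor.map_comp_apply, Functor.map_comp_apply]
    exact hmem'

theorem fibrePoint_fibreLine {T : (torsor k).obj R} {a c d l m : R.right}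
    (hT : IsNormalPair T.1.1.1 T.1.2.1 a c d l m) (Z : (conicBundle k).obj R)
    (hZ : bundleProj Z = torsorTraces T) : fibrePoint T (fibreLine hT Z hZ) = Z := by
  obtain ⟨S, f, hf, v, hv⟩ := (fibreLine hT Z hZ).exists_cover
  refine QuotientSection.eq_of_mem hf (p := ((torsor k).map f T,
    QuotientSection.mk' (isEquivRel_proportional k) v)) ?_ hv
  refine .of_rel ?_
  have : (projLine k).map f (fibreLine hT Z hZ) =
      QuotientSection.mk' (isEquivRel_proportional k) v :=
    QuotientSection.restrict_eq_mk' _ _ hv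
  rw [← this]
  exact ((isEquivRel_sameOrbit k).equiv S).refl _

end

/-! ### The projective line under restriction of the base -/

/-- Transport between two equal structure morphisms of the same ring, needed because `Under.mk`
carries the morphism in the type. -/
theorem mem_carrier_mk_iff {K : Type u} [CommRing K] {R : AlgOver K} (L : (projLine K).obj R)
    {A : CommRingCat.{u}} {s s' : CommRingCat.of K ⟶ A} (q : R.right ⟶ A) (w : R.hom ≫ q = s)
    (w' : R.hom ≫ q = s')
    (v : (puncturedPlane K).obj (Under.mk s)) :
    v ∈ L.carrier (Under.mk s) (Under.homMk q w) ↔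
      (show (puncturedPlane K).obj (Under.mk s') from v) ∈
        L.carrier (Under.mk s') (Under.homMk q w') := by
  subst w
  subst w'
  rfl

section

variable {k K : Type u} [CommRing k] [CommRing K] [Algebra k K]

/-- A `k`-algebra under a `K`-algebra `R`, as a `K`-algebra. -/
abbrev liftObj {R : AlgOver K} {S : AlgOver k} (f : (restrictBase k K).obj R ⟶ S) : AlgOver K :=
  Under.mk (R.hom ≫ (show R.right ⟶ S.right from f.right))

/-- A morphism of `k`-algebras that starts at a `K`-algebra, as a morphism of `K`-algebras. -/
abbrev liftHom {R : AlgOver K} {S : AlgOver k} (f : (restrictBase k K).obj R ⟶ S) :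
    R ⟶ liftObj f :=
  Under.homMk (show R.right ⟶ S.right from f.right) rfl

/-- Morphisms under a `K`-algebra are morphisms of `K`-algebras. -/
abbrev liftMap {R : AlgOver K} {S S' : AlgOver k} (f : (restrictBase k K).obj R ⟶ S)
    (g : S ⟶ S') : liftObj f ⟶ liftObj (f ≫ g) :=
  Under.homMk g.right (by simp; rfl)

/-- The points of `ℙ¹` over a `K`-algebra do not depend on the base: from `K` to `k`. -/
def lineRestrict {R : AlgOver K} (L : (projLine K).obj R) :
    (projLine k).obj ((restrictBase k K).obj R) where
  carrier S f := {v | (show (puncturedPlane K).obj (liftObj f) from v) ∈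
    L.carrier (liftObj f) (liftHom f)}
  map_mem S S' f g v hv := L.map_mem _ _ (liftHom f) (liftMap f g) v hv
  mem_of_cover S S' f g v hg hv :=
    L.mem_of_cover _ _ (liftHom f) (liftMap f g) v hg hv
  mem_of_rel S f v v' hv h := L.mem_of_rel _ (liftHom f) v v' hv h
  locRel S f v v' hv hv' := by
    obtain ⟨T, g, hg, h⟩ := L.locRel _ (liftHom f) v v' hv hv'
    exact ⟨Under.mk (S.hom ≫ g.right), Under.homMk g.right rfl, hg, h⟩
  exists_cover := by
    obtain ⟨S, f, hf, v, hv⟩ := L.exists_cover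
    refine ⟨(restrictBase k K).obj S, (restrictBase k K).map f, hf, v, ?_⟩
    exact (mem_carrier_mk_iff L f.right (Under.w f) rfl v).mp hv

theorem lineRestrict_map {R R' : AlgOver K} (h : R ⟶ R') (L : (projLine K).obj R) :
    (projLine k).map ((restrictBase k K).map h) (lineRestrict L) =
      lineRestrict ((projLine K).map h L) := by
  refine QuotientSection.ext (funext fun S => funext fun f => Set.ext fun v => ?_)
  have hw : R.hom ≫ h.right = R'.hom := Under.w h
  exact mem_carrier_mk_iff L (show R.right ⟶ S.right from h.right ≫ f.right) rfl
    (by rw [← hw, Category.assoc]) v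

theorem lineRestrict_lineAct {R : AlgOver K} (g : GL (Fin 2) R.right) (L : (projLine K).obj R) :
    lineRestrict (k := k) (lineAct g L) =
      lineAct (R := (restrictBase k K).obj R) g (lineRestrict L) :=
  rfl

/-- A k-algebra under a K-algebra `R` inherits a unique K-structure making the map from `R` a
K-morphism, and being an étale covering depends only on the ring map. So the test objects are the
same over k and over K, and the inverse merely forgets the K-structure. -/
theorem lineRestrict_bijective (R : AlgOver K) :
    Function.Bijective (lineRestrict : (projLine K).obj R →
      (projLine k).obj ((restrictBase k K).obj R)) := by
  refine Function.bijective_iff_has_inverse.mpr ⟨fun L =>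
    { carrier := fun S f => {v | (show (puncturedPlane k).obj ((restrictBase k K).obj S) from v) ∈
        L.carrier ((restrictBase k K).obj S) ((restrictBase k K).map f)}
      map_mem := fun S S' f g v hv => L.map_mem _ _ _ ((restrictBase k K).map g) v hv
      mem_of_cover := fun S S' f g v hg hv =>
        L.mem_of_cover _ _ _ ((restrictBase k K).map g) v hg hv
      mem_of_rel := fun S f v v' hv h => L.mem_of_rel ((restrictBase k K).obj S) _ v v' hv h
      locRel := fun S f v v' hv hv' => ?_
      exists_cover := ?_ }, fun L => ?_, fun L => ?_⟩
  · obtain ⟨T, g, hg, h⟩ := L.locRel ((restrictBase k K).obj S) _ v v' hv hv'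
    exact ⟨liftObj g, liftHom g, hg, h⟩
  · obtain ⟨S, f, hf, v, hv⟩ := L.exists_cover
    refine ⟨liftObj f, liftHom f, hf, v, ?_⟩
    exact (mem_carrier_mk_iff L f.right (Under.w f) rfl v).mp hv
  · refine QuotientSection.ext (funext fun S => funext fun f => Set.ext fun v => ?_)
    exact mem_carrier_mk_iff L f.right rfl (Under.w f) v
  · refine QuotientSection.ext (funext fun S => funext fun f => Set.ext fun v => ?_)
    exact mem_carrier_mk_iff L f.right rfl (Under.w f) v

end

/-! ### A normal pair over the algebraic closure with the generic traces -/

section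

variable {K : Type u} [Field K]

theorem gal_sqrtUnit (a : Kˣ) (σ : Gal(AlgebraicClosure K/K)) :
    σ (sqrtUnit a : AlgebraicClosure K) =
      ((kummer a σ : (AlgebraicClosure K)ˣ) : AlgebraicClosure K) * sqrtUnit a := by
  change _ = σ (sqrtUnit a : AlgebraicClosure K) * ((sqrtUnit a)⁻¹ : (AlgebraicClosure K)ˣ) * _
  rw [mul_assoc, Units.inv_mul, mul_one]

theorem gal_muTwo (x : MuTwo K) (σ : Gal(AlgebraicClosure K/K)) :
    σ ((x : (AlgebraicClosure K)ˣ) : AlgebraicClosure K) = (x : (AlgebraicClosure K)ˣ) :=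
  congrArg (fun y : MuTwo K => ((y : (AlgebraicClosure K)ˣ) : AlgebraicClosure K))
    (galMu_apply σ x)

theorem muTwo_val_mul_self (x : MuTwo K) :
    ((x : (AlgebraicClosure K)ˣ) : AlgebraicClosure K) * (x : (AlgebraicClosure K)ˣ) = 1 :=
  congrArg (fun y : MuTwo K => ((y : (AlgebraicClosure K)ˣ) : AlgebraicClosure K))
    (muTwo_mul_self x)

open Classical in
/-- The lift to `SL(2)` of the cocycle of the generic fibre, in terms of the Kummer cocycles of
`a` and `b`. -/
def cocycleLift (a b : Kˣ) (x y : MuTwo K) :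
    Matrix.SpecialLinearGroup (Fin 2) (AlgebraicClosure K) :=
  if x = 1 then 1 else
    ⟨!![0, (y : (AlgebraicClosure K)ˣ) * (sqrtUnit a / sqrtUnit b);
      -((y : (AlgebraicClosure K)ˣ) * (sqrtUnit b / sqrtUnit a)), 0], by
      have h := muTwo_val_mul_self y
      have ha := (sqrtUnit a).ne_zero
      have hb := (sqrtUnit b).ne_zero
      rw [Matrix.det_fin_two_of]
      field_simp
      linear_combination h⟩

theorem cocycleLift_one (a b : Kˣ) (y : MuTwo K) : cocycleLift a b 1 y = 1 := if_pos rfl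

theorem cocycleLift_of_ne_one (a b : Kˣ) {x : MuTwo K} (hx : x ≠ 1) (y : MuTwo K) :
    (cocycleLift a b x y).1 =
      (!![0, (y : (AlgebraicClosure K)ˣ) * (sqrtUnit a / sqrtUnit b);
        -((y : (AlgebraicClosure K)ˣ) * (sqrtUnit b / sqrtUnit a)), 0] :
          Matrix (Fin 2) (Fin 2) (AlgebraicClosure K)) :=
  congrArg Subtype.val (if_neg hx)

/-- Let J have rows (0, α/β), (-β/α, 0), with α, β the chosen roots of `a`, `b`; a nontrivial lift
is yJ. Since J² = -1 and σ(J) = x y J, where x and y are the signs by which σ moves α and β, the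
four cases leave the factor y(τ) when σ moves α, and 1 otherwise. -/
theorem cocycleLift_mul (a b : Kˣ) (σ τ : Gal(AlgebraicClosure K/K)) :
    (cocycleLift a b (kummer a σ) (kummer b σ) *
      Matrix.SpecialLinearGroup.map (σ : AlgebraicClosure K →+* AlgebraicClosure K)
        (cocycleLift a b (kummer a τ) (kummer b τ))).1 =
      ((muPairing (kummer a σ) (galMu σ (kummer b τ)) : (AlgebraicClosure K)ˣ) :
        AlgebraicClosure K) • (cocycleLift a b (kummer a (σ * τ)) (kummer b (σ * τ))).1 := by
  have ha := (sqrtUnit a).ne_zero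
  have hb := (sqrtUnit b).ne_zero
  have hσa := gal_sqrtUnit a σ
  have hσb := gal_sqrtUnit b σ
  have hg := gal_muTwo (kummer b τ) σ
  have hyσ := muTwo_val_mul_self (kummer b σ)
  have hyτ := muTwo_val_mul_self (kummer b τ)
  have hy0 := ((kummer b σ : (AlgebraicClosure K)ˣ)).ne_zero
  have hmul : ((kummer b σ * kummer b τ : MuTwo K) : (AlgebraicClosure K)ˣ) =
    (kummer b σ : (AlgebraicClosure K)ˣ) * (kummer b τ : (AlgebraicClosure K)ˣ) := rfl
  rw [galMu_apply, kummer_mul, kummer_mul]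
  change (cocycleLift a b (kummer a σ) (kummer b σ)).1 *
    (cocycleLift a b (kummer a τ) (kummer b τ)).1.map σ = _
  by_cases h1 : kummer a σ = 1
  · rw [h1] at hσa ⊢
    rw [one_mul, show muPairing 1 (kummer b τ) = 1 from if_pos rfl, cocycleLift_one]
    by_cases h2 : kummer a τ = 1
    · rw [h2, cocycleLift_one, cocycleLift_one]
      simp
    · rw [cocycleLift_of_ne_one a b h2, cocycleLift_of_ne_one a b h2, hmul]
      ext i j
      fin_cases i <;> fin_cases j <;> simp [hσa, hσb, hg] <;> field_simp <;> grind
  · have e1 := (muTwo_eq_or _).resolve_left h1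
    rw [e1] at hσa
    rw [show muPairing (kummer a σ) (kummer b τ) = kummer b τ from if_neg h1,
      cocycleLift_of_ne_one a b h1]
    by_cases h2 : kummer a τ = 1
    · rw [h2, mul_one, cocycleLift_one, cocycleLift_of_ne_one a b h1, hmul]
      ext i j
      fin_cases i <;> fin_cases j <;>
        simp [Matrix.mul_apply, Fin.sum_univ_two] <;> field_simp <;> grind
    · have e2 := (muTwo_eq_or _).resolve_left h2
      -- When both automorphisms move α, the sign from σ(α) = -α cancels the one from J² = -1, and
      -- στ fixes α.
      have h3 : kummer a σ * kummer a τ = 1 :=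
        Subtype.ext (Units.ext (by
          change ((kummer a σ : (AlgebraicClosure K)ˣ) : AlgebraicClosure K) *
            (kummer a τ : (AlgebraicClosure K)ˣ) = 1
          rw [e1, e2]; ring))
      rw [h3, cocycleLift_one, cocycleLift_of_ne_one a b h2]
      ext i j
      fin_cases i <;> fin_cases j <;>
        simp [Matrix.mul_apply, Fin.sum_univ_two, hσa, hσb, hg] <;> field_simp <;> grind

end

/-! ### The generic pair and its Galois conjugates -/

section

variable (k : Type u) [Field k] [CharZero k]

/-- `t² - 4` as a unit of `K`. -/
abbrev discUnit : (FunField k)ˣ := Units.mk0 (coord k 1 ^ 2 - 4) (coord_sq_sub_four_ne_zero k)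

/-- `F(s,t,u)` as a unit of `K`. -/
abbrev cayleyUnit : (FunField k)ˣ :=
  Units.mk0 (cayley (coord k 0) (coord k 1) (coord k 2)) (cayley_coord_ne_zero k)

/-- The coordinates `s`, `t`, `u` in the algebraic closure of `K`. -/
def closureCoord (i : Fin 3) : AlgebraicClosure (FunField k) := algebraMap _ _ (coord k i)

/-- A square root of `t² - 4`. -/
def discRoot : AlgebraicClosure (FunField k) := sqrtUnit (discUnit k)

/-- A square root of `F(s,t,u)`. -/
def cayleyRoot : AlgebraicClosure (FunField k) := sqrtUnit (cayleyUnit k)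

theorem discRoot_ne_zero : discRoot k ≠ 0 := (sqrtUnit _).ne_zero

theorem cayleyRoot_ne_zero : cayleyRoot k ≠ 0 := (sqrtUnit _).ne_zero

theorem discRoot_sq : discRoot k ^ 2 = closureCoord k 1 ^ 2 - 4 := by
  rw [discRoot, sqrtUnit_sq]
  change algebraMap _ _ (coord k 1 ^ 2 - 4) = _
  rw [map_sub, map_pow, map_ofNat]
  rfl

theorem cayleyRoot_sq : cayleyRoot k ^ 2 =
    cayley (closureCoord k 0) (closureCoord k 1) (closureCoord k 2) := by
  rw [cayleyRoot, sqrtUnit_sq]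
  exact cayley_map (algebraMap (FunField k) (AlgebraicClosure (FunField k))) _ _ _

/-- The diagonal matrix `B` of trace `t`. -/
def genericRight : Matrix.SpecialLinearGroup (Fin 2) (AlgebraicClosure (FunField k)) :=
  ⟨!![(closureCoord k 1 + discRoot k) / 2, 0; 0, (closureCoord k 1 - discRoot k) / 2], by
    rw [Matrix.det_fin_two_of]
    linear_combination -(discRoot_sq k) / 4⟩

/-- The matrix `A` of trace `s` such that `AB` has trace `u`. -/
def genericLeft : Matrix.SpecialLinearGroup (Fin 2) (AlgebraicClosure (FunField k)) :=
  -- With l - m = α, the diagonal entries a, d solve a + d = s and al + dm = u. The lower left entry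
  -- is ad - 1 = -F/(t² - 4), written through the square roots.
  ⟨!![(closureCoord k 2 - closureCoord k 0 * ((closureCoord k 1 - discRoot k) / 2)) / discRoot k,
      1; -(cayleyRoot k / discRoot k) ^ 2,
      (closureCoord k 0 * ((closureCoord k 1 + discRoot k) / 2) - closureCoord k 2) /
        discRoot k], by
    have h0 := discRoot_ne_zero k
    have h1 := discRoot_sq k
    have h2 := cayleyRoot_sq k
    rw [cayley] at h2
    rw [Matrix.det_fin_two_of]
    field_simp
    grind⟩

theorem isNormalPair_generic : ∃ a c d l m, IsNormalPair (genericLeft k).1 (genericRight k).1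
    a c d l m := by
  refine ⟨_, _, _, _, _, rfl, rfl, ?_, ?_⟩
  · have : (closureCoord k 1 + discRoot k) / 2 - (closureCoord k 1 - discRoot k) / 2 =
      discRoot k := by ring
    rw [this]
    exact (discRoot_ne_zero k).isUnit
  · exact (neg_ne_zero.mpr (pow_ne_zero 2
      (div_ne_zero (cayleyRoot_ne_zero k) (discRoot_ne_zero k)))).isUnit

theorem traces_generic : traces (genericLeft k, genericRight k) =
    (closureCoord k 0, closureCoord k 1, closureCoord k 2) := by
  have h0 := discRoot_ne_zero k
  have h1 := discRoot_sq k
  refine Prod.ext ?_ (Prod.ext ?_ ?_)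
  · simp [traces, Matrix.trace_fin_two, genericLeft]
    field_simp
    ring
  · simp [traces, Matrix.trace_fin_two, genericRight]
    ring
  · simp [traces, Matrix.trace_fin_two, genericLeft, genericRight]
    field_simp
    ring

/-- The Galois conjugates of the generic pair are conjugate to it by the lift of the cocycle. -/
theorem genericPair_conj (σ : Gal(AlgebraicClosure (FunField k)/FunField k)) :
    (cocycleLift (discUnit k) (cayleyUnit k) (kummer (discUnit k) σ) (kummer (cayleyUnit k) σ)).1 *
        (genericLeft k).1.map σ = (genericLeft k).1 * (cocycleLift (discUnit k) (cayleyUnit k)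
          (kummer (discUnit k) σ) (kummer (cayleyUnit k) σ)).1 ∧
      (cocycleLift (discUnit k) (cayleyUnit k) (kummer (discUnit k) σ)
        (kummer (cayleyUnit k) σ)).1 *
        (genericRight k).1.map σ = (genericRight k).1 * (cocycleLift (discUnit k) (cayleyUnit k)
          (kummer (discUnit k) σ) (kummer (cayleyUnit k) σ)).1 := by
  have hδ := discRoot_ne_zero k
  have hβ := cayleyRoot_ne_zero k
  have hc : ∀ i, σ (closureCoord k i) = closureCoord k i := fun i => σ.commutes _
  have h2 : σ 2 = 2 := map_ofNat σ 2
  have hσa : σ (discRoot k) = _ * discRoot k := gal_sqrtUnit (discUnit k) σ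
  have hσb : σ (cayleyRoot k) = _ * cayleyRoot k := gal_sqrtUnit (cayleyUnit k) σ
  have hy := muTwo_val_mul_self (kummer (cayleyUnit k) σ)
  by_cases h1 : kummer (discUnit k) σ = 1
  -- If σ fixes α, the pair is fixed: β enters `A` only through its square.
  · rw [h1] at hσa ⊢
    rw [cocycleLift_one]
    constructor <;> ext i j <;> fin_cases i <;> fin_cases j <;>
      simp [genericLeft, genericRight, hσa, hσb, hc, h2] <;> field_simp <;> grind
  -- If σ(α) = -α, the diagonal entries of each matrix are exchanged. The antidiagonal lift
  -- exchanges them back, and its entries match the off-diagonal ones of `A` because these are 1 and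
  -- -(β/α)².
  · rw [(muTwo_eq_or _).resolve_left h1] at hσa
    rw [cocycleLift_of_ne_one _ _ h1, ← discRoot, ← cayleyRoot]
    constructor <;> ext i j <;> fin_cases i <;> fin_cases j <;>
      simp [genericLeft, genericRight, hσa, hσb, hc, h2, Matrix.mul_apply, Fin.sum_univ_two] <;>
      field_simp <;> grind

end

/-! ### The trivialization of the generic fibre over the algebraic closure -/

section

variable (k : Type u) [Field k] [CharZero k]

/-- The `k`-algebra underlying an algebra over the algebraic closure of `K`. -/
abbrev underlying : AlgOver (AlgebraicClosure (FunField k)) ⥤ AlgOver k :=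
  restrictBase (FunField k) (AlgebraicClosure (FunField k)) ⋙ restrictBase k (FunField k)

/-- The structure morphism of an algebra `R`. -/
def fromInitial {C : Type u} [CommRing C] (R : AlgOver C) :
    Under.mk (𝟙 (CommRingCat.of C)) ⟶ R :=
  Under.homMk R.hom (Category.id_comp _)

theorem fromInitial_comp {C : Type u} [CommRing C] {R R' : AlgOver C} (f : R ⟶ R') :
    fromInitial R ≫ f = fromInitial R' :=
  Under.UnderMorphism.ext (Under.w f)

theorem isUnit_cayley_generic : IsUnit (cayley (traces (genericLeft k, genericRight k)).1
    (traces (genericLeft k, genericRight k)).2.1 (traces (genericLeft k, genericRight k)).2.2) := by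
  rw [traces_generic, ← cayleyRoot_sq]
  exact (pow_ne_zero 2 (cayleyRoot_ne_zero k)).isUnit

/-- The generic normal pair as a point of the torsor. -/
def genericPair : (torsor k).obj ((underlying k).obj
    (Under.mk (𝟙 (CommRingCat.of (AlgebraicClosure (FunField k)))))) :=
  ⟨(genericLeft k, genericRight k), isUnit_cayley_generic k⟩

/-- The generic normal pair over an algebra over the algebraic closure of `K`. -/
def genericPairOver (R : AlgOver (AlgebraicClosure (FunField k))) :
    (torsor k).obj ((underlying k).obj R) :=
  (torsor k).map ((underlying k).map (fromInitial R)) (genericPair k)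

theorem genericPairOver_map {R R' : AlgOver (AlgebraicClosure (FunField k))} (f : R ⟶ R') :
    (torsor k).map ((underlying k).map f) (genericPairOver k R) = genericPairOver k R' := by
  rw [genericPairOver, ← Functor.map_comp_apply, ← Functor.map_comp, fromInitial_comp]
  rfl

theorem genericPairOver_initial :
    genericPairOver k (Under.mk (𝟙 (CommRingCat.of (AlgebraicClosure (FunField k))))) =
      genericPair k := by
  have : fromInitial (Under.mk (𝟙 (CommRingCat.of (AlgebraicClosure (FunField k))))) = 𝟙 _ := rfl
  rw [genericPairOver, this, CategoryTheory.Functor.map_id, Functor.map_id_apply]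

theorem torsorTraces_genericPairOver (R : AlgOver (AlgebraicClosure (FunField k))) :
    torsorTraces (genericPairOver k R) = genericPoint k
      ((restrictBase (FunField k) (AlgebraicClosure (FunField k))).obj R) := by
  have h : torsorTraces (genericPair k) = genericPoint k (closurePt (FunField k)) :=
    Subtype.ext (traces_generic k)
  rw [genericPairOver, torsorTraces_map, h]
  exact genericPoint_map k
    ((restrictBase (FunField k) (AlgebraicClosure (FunField k))).map (fromInitial R))

theorem isNormalPair_genericPairOver (R : AlgOver (AlgebraicClosure (FunField k))) :
    ∃ a c d l m, IsNormalPair (genericPairOver k R).1.1.1 (genericPairOver k R).1.2.1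
      a c d l m := by
  obtain ⟨a, c, d, l, m, h⟩ := isNormalPair_generic k
  exact ⟨_, _, _, _, _, IsNormalPair.torsor_map (T := genericPair k) h _⟩

/-- The isomorphism `ℙ¹ ⟶ X_K` over the algebraic closure, on points. -/
def trivializationApp (R : AlgOver (AlgebraicClosure (FunField k)))
    (L : (restrictBase (FunField k) (AlgebraicClosure (FunField k)) ⋙
      projLine (FunField k)).obj R) :
    (restrictBase (FunField k) (AlgebraicClosure (FunField k)) ⋙ genericFibre k).obj R :=
  ⟨fibrePoint (genericPairOver k R) (lineRestrict (k := k) (K := FunField k) L), by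
    rw [bundleProj_fibrePoint, torsorTraces_genericPairOver]⟩

/-- The fibre over the traces of a normal pair is ℙ¹ over every algebra over the algebraic closure:
`fibreLine` provides preimages and `fibrePoint_injective` gives uniqueness. -/
theorem trivializationApp_bijective (R : AlgOver (AlgebraicClosure (FunField k))) :
    Function.Bijective (trivializationApp k R) := by
  obtain ⟨a, c, d, l, m, hT⟩ := isNormalPair_genericPairOver k R
  refine ⟨fun L L' h => ?_, fun Z => ?_⟩
  · exact (lineRestrict_bijective _).1 (fibrePoint_injective hT (congrArg Subtype.val h))
  · have hZ : bundleProj Z.1 = torsorTraces (genericPairOver k R) :=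
      Z.2.trans (torsorTraces_genericPairOver k R).symm
    obtain ⟨L, hL⟩ := (lineRestrict_bijective (K := FunField k) _).2 (fibreLine hT Z.1 hZ)
    refine ⟨L, Subtype.ext ?_⟩
    change fibrePoint (genericPairOver k R) (lineRestrict (K := FunField k) L) = Z.1
    rw [hL]
    exact fibrePoint_fibreLine hT Z.1 hZ

/-- The isomorphism `ℙ¹ ⟶ X_K` over the algebraic closure of `K`. -/
def trivialization : restrictBase (FunField k) (AlgebraicClosure (FunField k)) ⋙
    projLine (FunField k) ≅
      restrictBase (FunField k) (AlgebraicClosure (FunField k)) ⋙ genericFibre k :=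
  NatIso.ofComponents (fun R => (Equiv.ofBijective _ (trivializationApp_bijective k R)).toIso) (by
    intro R R' f
    refine ConcreteCategory.hom_ext _ _ fun L => Subtype.ext ?_
    change fibrePoint (genericPairOver k R')
      (lineRestrict (K := FunField k) ((projLine (FunField k)).map
        ((restrictBase (FunField k) (AlgebraicClosure (FunField k))).map f) L)) =
      (conicBundle k).map ((underlying k).map f)
        (fibrePoint (genericPairOver k R) (lineRestrict (K := FunField k) L))
    rw [fibrePoint_map, genericPairOver_map, ← lineRestrict_map]
    rfl)

/-- σ sends [(A, B), L] to [σ(A, B), σ(L)]; conjugating by the lift g of the cocycle turns σ(A, B)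
back into (A, B) and σ(L) into gσ(L). -/
theorem trivialization_gal (σ : Gal(AlgebraicClosure (FunField k)/FunField k))
    (L : (projLine (FunField k)).obj (closurePt (FunField k))) :
    (genericFibre k).map (galHom σ) (trivializationApp k (Under.mk (𝟙 (CommRingCat.of
        (AlgebraicClosure (FunField k))))) L) =
      trivializationApp k (Under.mk (𝟙 (CommRingCat.of (AlgebraicClosure (FunField k)))))
        (lineAct (R := closurePt (FunField k)) (Matrix.SpecialLinearGroup.toGL
          (cocycleLift (discUnit k) (cayleyUnit k) (kummer (discUnit k) σ)
            (kummer (cayleyUnit k) σ)))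
          ((projLine (FunField k)).map (galHom σ) L)) := by
  refine Subtype.ext ?_
  generalize hg : cocycleLift (discUnit k) (cayleyUnit k) (kummer (discUnit k) σ)
    (kummer (cayleyUnit k) σ) = g
  change (conicBundle k).map ((restrictBase k (FunField k)).map (galHom σ))
      (fibrePoint
        (genericPairOver k (Under.mk (𝟙 (CommRingCat.of (AlgebraicClosure (FunField k))))))
        (lineRestrict (K := FunField k) L)) =
    fibrePoint (genericPairOver k (Under.mk (𝟙 (CommRingCat.of (AlgebraicClosure (FunField k))))))
      (lineRestrict (K := FunField k) (lineAct (R := closurePt (FunField k))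
        (Matrix.SpecialLinearGroup.toGL g) ((projLine (FunField k)).map (galHom σ) L)))
  rw [genericPairOver_initial, fibrePoint_map, lineRestrict_lineAct, ← lineRestrict_map]
  have conj : ∀ {M N : Matrix (Fin 2) (Fin 2) (AlgebraicClosure (FunField k))}, g.1 * M = N * g.1 →
      N = (Matrix.SpecialLinearGroup.toGL g).1 * M * ((Matrix.SpecialLinearGroup.toGL g)⁻¹).1 := by
    intro M N h
    have h' : (Matrix.SpecialLinearGroup.toGL g).1 * M = N * (Matrix.SpecialLinearGroup.toGL g).1 :=
      h
    rw [h', Matrix.mul_assoc, ← Units.val_mul, mul_inv_cancel, Units.val_one, Matrix.mul_one]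
  have hc := genericPair_conj k σ
  rw [hg] at hc
  exact fibrePoint_eq_of_conj (T' := genericPair k) _ (conj hc.1) (conj hc.2) _

end

end

end TraceConic

/-! ### The class of the generic fibre -/

theorem mainTheorem6 (k : Type u) [Field k] [CharZero k] :
    TraceConic.HasBrauerClass (TraceConic.genericFibre k)
      (TraceConic.symbol
        (Units.mk0 (TraceConic.coord k 1 ^ 2 - 4) (TraceConic.coord_sq_sub_four_ne_zero k))
        (Units.mk0 (TraceConic.cayley (TraceConic.coord k 0) (TraceConic.coord k 1)
          (TraceConic.coord k 2)) (TraceConic.cayley_coord_ne_zero k))) := by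
  -- The 2-cocycle is the very representative that defines `symbol`, so the equality of classes is
  -- `rfl`. The lift is locally constant because it depends on σ only through the two Kummer
  -- cocycles.
  refine ⟨TraceConic.trivialization k, fun σ =>
    TraceConic.cocycleLift (TraceConic.discUnit k) (TraceConic.cayleyUnit k)
      (TraceConic.kummer _ σ) (TraceConic.kummer _ σ), _, ?_,
    TraceConic.trivialization_gal k, fun σ τ => TraceConic.cocycleLift_mul _ _ σ τ, rfl⟩
  exact (TraceConic.kummer_isLocallyConstant _).comp₂ (TraceConic.kummer_isLocallyConstant _) _
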